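/- There are absolute constants $C,c>0$ such that for every integer $n\ge 1$ there exist a closed orientable surface $M$ (a compact connected orientable $2$-manifold without boundary) and a cubulation of $M$ with at most $C n$ vertices and at least $c\,n^2$ squares. Here a cubulation of $M$ is a presentation of $M$ as a union of finitely many pairwise distinct topological squares (homeomorphic images of $[0,1]^2$) such that the intersection of any two of them is a face of both, where the faces of a square are the empty set, its four vertices, its four edges and the square itself; the vertices of the cubulation are the vertices of its squares. -/

import Mathlib

open Set Topology
open scoped Manifold ContDiff unitInterval

/-- A face of the standard square `[0,1]²`: the empty face, or a product `A × B` in which each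
factor is `{0}`, `{1}` or `[0,1]` (four vertices, four edges, and the square itself). -/
def IsSquareFace (F : Set (I × I)) : Prop :=
  F = ∅ ∨ ∃ A B : Set I, (A = {0} ∨ A = {1} ∨ A = univ) ∧ (B = {0} ∨ B = {1} ∨ B = univ) ∧
    F = A ×ˢ B

/-- The four corners of the standard square `[0,1]²`. -/
def squareCorners : Set (I × I) := ({0, 1} : Set I) ×ˢ ({0, 1} : Set I)

/-- A cubulation of a (two-dimensional) space `X`: `X` is the union of finitely many pairwise
distinct topological squares, and the intersection of any two of them is a face of both.
`map i` parametrizes the `i`-th square by `[0,1]²`; the faces of that square are the images of the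
faces of `[0,1]²`. -/
structure SquareCubulation (X : Type*) [TopologicalSpace X] where
  /-- The (finite) set of squares. -/
  Square : Type
  finite_square : Finite Square
  /-- The parametrizations of the squares. -/
  map : Square → I × I → X
  isEmbedding_map : ∀ i, IsEmbedding (map i)
  iUnion_range : ⋃ i, range (map i) = univ
  /-- Different indices give different subsets of `X`. -/
  range_injective : Function.Injective fun i => range (map i)
  inter_isFace : ∀ i j, ∃ F G : Set (I × I), IsSquareFace F ∧ IsSquareFace G ∧
    range (map i) ∩ range (map j) = map i '' F ∧ range (map i) ∩ range (map j) = map j '' G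

namespace SquareCubulation

variable {X : Type*} [TopologicalSpace X]

/-- The set of vertices of a cubulation: the corners of all of its squares. -/
def vertices (Q : SquareCubulation X) : Set X := ⋃ i, Q.map i '' squareCorners

theorem finite_vertices (Q : SquareCubulation X) : Q.vertices.Finite := by
  have := Q.finite_square
  refine Set.finite_iUnion fun i => Set.Finite.image _ ?_
  exact Set.Finite.prod (Set.toFinite _) (Set.toFinite _)

/-- The number of vertices. -/
noncomputable def numVertices (Q : SquareCubulation X) : ℕ := Q.vertices.ncard

/-- The number of squares. -/
noncomputable def numSquares (Q : SquareCubulation X) : ℕ := Nat.card Q.Square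

end SquareCubulation

/-- `M` is a closed orientable surface: a nonempty connected compact Hausdorff space with an
oriented smooth atlas modelled on the plane, that is, an atlas without boundary all of whose
transition maps are smooth with positive Jacobian determinant. (Every topological surface carries
a smooth structure, so this is the usual topological notion.) -/
structure IsClosedOrientableSurface (M : Type*) [TopologicalSpace M] : Prop where
  compactSpace : CompactSpace M
  t2Space : T2Space M
  connectedSpace : ConnectedSpace M
  exists_orientedAtlas : ∃ _ : ChartedSpace (EuclideanSpace ℝ (Fin 2)) M,
    IsManifold (𝓡 2) ∞ M ∧
    ∀ e ∈ atlas (EuclideanSpace ℝ (Fin 2)) M, ∀ e' ∈ atlas (EuclideanSpace ℝ (Fin 2)) M,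
      ∀ x ∈ (e.symm.trans e').source, 0 < (fderiv ℝ (e.symm.trans e') x).det

/-! Tile the torus by a 4 × 4 grid of squares and take a cover with group (ℤ/m)², m odd, branched
over the 16 grid vertices, with monodromy of order m around each of them. Every square lifts to m²
squares, but the fibre over a grid vertex is the set of cosets of a cyclic group of order m, so it
has only m points: 16m vertices against 16m² squares. Taking m = 2n + 1 gives the bounds.

The lifted squares have to meet in faces. The monodromies are chosen so that those at two distinct
corners of one square have determinant dividing 2, hence form a basis of (ℤ/m)². The cosets at two
corners then determine the sheet (`tile_eq_of_flagVert_eq`), so distinct lifts of a square share at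
most one vertex.

`QuadMap` isolates the combinatorics that is needed. Its squares are realized by bilinear
interpolation in the functions on the vertex set, and the incidence axioms make two squares with a
common vertex meet exactly where they are glued (`glued_iff_cell_eq`). The 4m quadrants around a
vertex form a cone of angle 2πm, which an m-th root flattens to a planar region (`exists_chart`).
The m-th powers of two charts differ by a locally constant function, so the transition maps are
locally biholomorphic (`exists_hasDerivAt_transition`) and the atlas is oriented. -/

/-- A combinatorial surface tiled by squares. The corners of a square `s` are numbered
counterclockwise by `ZMod 4`; the pairs `(s, r)` are the corner flags, `vert` sends a flag to the
vertex it sits at, and `next` rotates a flag counterclockwise about its vertex. Around every vertex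
there are exactly `4 * m` flags, and they are surrounded by pairwise distinct vertices. -/
structure QuadMap (S V : Type) (m : ℕ) where
  next : Equiv.Perm (S × ZMod 4)
  vert : S × ZMod 4 → V
  vert_surjective : Function.Surjective vert
  next_snd : ∀ d, (next d).2 = d.2 + 1
  vert_next : ∀ d, vert (next d) = vert d
  vert_edge : ∀ d, vert (d.1, d.2 + 3) = vert ((next d).1, d.2 + 2)
  exists_zpow : ∀ d d', vert d = vert d' → ∃ k : ℤ, (next ^ k) d = d'
  zpow_eq_self_iff : ∀ d (k : ℤ), (next ^ k) d = d ↔ (4 * m : ℤ) ∣ k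
  vert_injective : ∀ s r r', vert (s, r) = vert (s, r') → r = r'
  edge_injective : ∀ d d', vert d = vert d' →
    vert (d.1, d.2 + 1) = vert (d'.1, d'.2 + 1) → d = d'
  opp_injective : ∀ d d', vert d = vert d' →
    vert (d.1, d.2 + 2) = vert (d'.1, d'.2 + 2) → d = d'
  edge_ne_opp : ∀ d d', vert d = vert d' → vert (d.1, d.2 + 1) ≠ vert (d'.1, d'.2 + 2)

/-! ### Bilinear realization of the squares and their gluing. -/

/-- The bilinear weights of the four corners of the unit square. -/
def cornerWeight (j : ZMod 4) (z : I × I) : ℝ :=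
  (![(1 - z.1) * (1 - z.2), z.1 * (1 - z.2), z.1 * z.2, (1 - z.1) * z.2] : Fin 4 → ℝ) j

theorem cornerWeight_zero (z : I × I) : cornerWeight 0 z = (1 - z.1) * (1 - z.2) := rfl
theorem cornerWeight_one (z : I × I) : cornerWeight 1 z = z.1 * (1 - z.2) := rfl
theorem cornerWeight_two (z : I × I) : cornerWeight 2 z = z.1 * z.2 := rfl
theorem cornerWeight_three (z : I × I) : cornerWeight 3 z = (1 - z.1) * z.2 := rfl

theorem ZMod.four_cases (j : ZMod 4) : j = 0 ∨ j = 1 ∨ j = 2 ∨ j = 3 := by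
  revert j; decide

theorem continuous_cornerWeight (j : ZMod 4) : Continuous (cornerWeight j) := by
  rcases ZMod.four_cases j with rfl | rfl | rfl | rfl
  · simp only [funext cornerWeight_zero]; fun_prop
  · simp only [funext cornerWeight_one]; fun_prop
  · simp only [funext cornerWeight_two]; fun_prop
  · simp only [funext cornerWeight_three]; fun_prop

/-- The coordinates of a point of the unit square after a quarter turn of the frame. -/
def quarterTurn (z : I × I) : I × I := (z.2, unitInterval.symm z.1)

theorem cornerWeight_quarterTurn (j : ZMod 4) (z : I × I) :
    cornerWeight j (quarterTurn z) = cornerWeight (j + 1) z := by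
  rcases ZMod.four_cases j with rfl | rfl | rfl | rfl
  · rw [zero_add, cornerWeight_zero, cornerWeight_one]; simp [quarterTurn]; ring
  · rw [show (1 + 1 : ZMod 4) = 2 from rfl, cornerWeight_one, cornerWeight_two]
    simp [quarterTurn]; ring
  · rw [show (2 + 1 : ZMod 4) = 3 from rfl, cornerWeight_two, cornerWeight_three]
    simp [quarterTurn]; ring
  · rw [show (3 + 1 : ZMod 4) = 0 from rfl, cornerWeight_three, cornerWeight_zero]
    simp [quarterTurn]; ring

namespace QuadMap

variable {S V : Type} {m : ℕ} (T : QuadMap S V m)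

/-- The vertex of the square of the flag `d`, `j` steps after `d`. -/
def corner (d : S × ZMod 4) (j : ZMod 4) : V := T.vert (d.1, d.2 + j)

theorem corner_zero (d : S × ZMod 4) : T.corner d 0 = T.vert d := by simp [corner]

theorem corner_injective (d : S × ZMod 4) : Function.Injective (T.corner d) := fun _ _ h =>
  add_left_cancel (T.vert_injective _ _ _ h)

theorem corner_three (d : S × ZMod 4) : T.corner d 3 = T.corner (T.next d) 1 := by
  rw [corner, T.vert_edge, corner, T.next_snd, add_assoc]; rfl

theorem corner_add_one (s : S) (r j : ZMod 4) :
    T.corner (s, r + 1) j = T.corner (s, r) (j + 1) := by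
  simp only [corner]; congr 2; ring

open Classical in
/-- The square of the flag `d`, realized by bilinear interpolation in the space spanned by the
vertices, with the coordinate axes emanating from the vertex of `d`. -/
noncomputable def cell (d : S × ZMod 4) (z : I × I) : V → ℝ := fun u =>
  ∑ j : ZMod 4, if T.corner d j = u then cornerWeight j z else 0

theorem cell_corner (d : S × ZMod 4) (z : I × I) (j : ZMod 4) :
    T.cell d z (T.corner d j) = cornerWeight j z := by
  classical
  simp only [cell, (T.corner_injective d).eq_iff]
  simp

theorem cell_vert {d : S × ZMod 4} {v : V} (h : T.vert d = v) (z : I × I) :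
    T.cell d z v = (1 - z.1) * (1 - z.2) := by
  rw [← h, ← T.corner_zero, cell_corner, cornerWeight_zero]

/-- Equal points of two squares have equal supports in the vertex set; this turns a geometric
intersection into common corners. -/
theorem exists_corner_of_cell_ne_zero {d : S × ZMod 4} {z : I × I} {u : V}
    (h : T.cell d z u ≠ 0) : ∃ j, T.corner d j = u ∧ cornerWeight j z ≠ 0 := by
  classical
  obtain ⟨j, -, hj⟩ := Finset.exists_ne_zero_of_sum_ne_zero h
  have hju : T.corner d j = u := by by_contra hne; simp [hne] at hj
  exact ⟨j, hju, by rwa [if_pos hju] at hj⟩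

theorem continuous_cell (d : S × ZMod 4) : Continuous (T.cell d) := by
  classical
  refine continuous_pi fun u => continuous_finsetSum _ fun j _ => ?_
  split_ifs
  · exact continuous_cornerWeight j
  · exact continuous_const

theorem cell_injective (d : S × ZMod 4) : Function.Injective (T.cell d) := by
  intro z z' h
  have hj : ∀ j, cornerWeight j z = cornerWeight j z' := fun j => by
    rw [← T.cell_corner d, ← T.cell_corner d, h]
  have h1 := hj 1
  have h2 := hj 2
  have h3 := hj 3
  rw [cornerWeight_one, cornerWeight_one] at h1
  rw [cornerWeight_two, cornerWeight_two] at h2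
  rw [cornerWeight_three, cornerWeight_three] at h3
  refine Prod.ext (Subtype.ext ?_) (Subtype.ext ?_) <;> linarith

/-- The four flags of a square parametrize the same set; only the corner used as origin changes. -/
theorem cell_quarterTurn (s : S) (r : ZMod 4) (z : I × I) :
    T.cell (s, r + 1) (quarterTurn z) = T.cell (s, r) z := by
  classical
  ext u
  simp only [cell, corner_add_one, cornerWeight_quarterTurn]
  exact Equiv.sum_comp (Equiv.addRight (1 : ZMod 4))
    fun j => if T.corner (s, r) j = u then cornerWeight j z else 0

/-- Consecutive flags share an edge: the two sides have the same end vertices, and interpolation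
along an edge involves no others. -/
theorem cell_next (d : S × ZMod 4) (t : I) :
    T.cell d (0, t) = T.cell (T.next d) (t, 0) := by
  classical
  ext u
  have h (f : ZMod 4 → ℝ) : ∑ j, f j = f 0 + f 1 + f 2 + f 3 := Fin.sum_univ_four f
  simp only [cell, h, corner_zero, T.vert_next, corner_three, cornerWeight_zero, cornerWeight_one,
    cornerWeight_two, cornerWeight_three]
  simp

theorem cell_zero {d d' : S × ZMod 4} (h : T.vert d = T.vert d') :
    T.cell d (0, 0) = T.cell d' (0, 0) := by
  classical
  ext u
  have h (f : ZMod 4 → ℝ) : ∑ j, f j = f 0 + f 1 + f 2 + f 3 := Fin.sum_univ_four f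
  simp only [cell, h, corner_zero, cornerWeight_zero, cornerWeight_one,
    cornerWeight_two, cornerWeight_three]
  simp [*]

/-- The gluing relation between the squares around a vertex. -/
def Glued (d : S × ZMod 4) (z : I × I) (d' : S × ZMod 4) (z' : I × I) : Prop :=
  (d = d' ∧ z = z') ∨ (z = 0 ∧ z' = 0) ∨
  (T.next d = d' ∧ z.1 = 0 ∧ z'.2 = 0 ∧ z.2 = z'.1) ∨
  (T.next d' = d ∧ z'.1 = 0 ∧ z.2 = 0 ∧ z'.2 = z.1)

theorem Glued.cell_eq {d d' : S × ZMod 4} {z z' : I × I} (hv : T.vert d = T.vert d')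
    (h : T.Glued d z d' z') : T.cell d z = T.cell d' z' := by
  obtain ⟨x, y⟩ := z
  obtain ⟨x', y'⟩ := z'
  rcases h with ⟨rfl, h⟩ | ⟨h, h'⟩ | ⟨rfl, h1, h2, h3⟩ | ⟨rfl, h1, h2, h3⟩
  · rw [h]
  · rw [h, h']; exact T.cell_zero hv
  · dsimp only at h1 h2 h3; subst h1 h2 h3; exact T.cell_next _ _
  · dsimp only at h1 h2 h3; subst h1 h2 h3; exact (T.cell_next _ _).symm

theorem next_next_ne (d : S × ZMod 4) : T.next (T.next d) ≠ d := by
  intro h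
  have := congrArg Prod.snd h
  rw [T.next_snd, T.next_snd, add_assoc, add_eq_left] at this
  exact absurd this (by decide)

/-- Two distinct squares at a common vertex only share points of the axes, and points other than
the vertex only when they are consecutive. -/
theorem axis_of_cell_eq {d d' : S × ZMod 4} {z z' : I × I} (hv : T.vert d = T.vert d')
    (hne : d ≠ d') (h : T.cell d z = T.cell d' z') :
    (z.1 = 0 ∨ T.next d' = d) ∧ (z.2 = 0 ∨ T.next d = d') ∧ (z.1 = 0 ∨ z.2 = 0) := by
  have key (j : ZMod 4) (hj : cornerWeight j z ≠ 0) : ∃ j', T.corner d' j' = T.corner d j := by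
    refine (T.exists_corner_of_cell_ne_zero (z := z') ?_).imp fun _ => And.left
    rwa [← h, cell_corner]
  -- A positive weight at the opposite corner would make it a corner of the other square, and each
  -- of its four possible positions there is excluded by an incidence axiom.
  have k2 : cornerWeight 2 z = 0 := by
    by_contra h2
    obtain ⟨j, hj⟩ := key 2 h2
    rcases ZMod.four_cases j with rfl | rfl | rfl | rfl
    · rw [corner_zero, ← hv, ← corner_zero] at hj
      exact absurd (T.corner_injective d hj) (by decide)
    · exact T.edge_ne_opp _ _ hv.symm hj
    · exact hne (T.opp_injective _ _ hv hj.symm)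
    · rw [corner_three] at hj
      exact T.edge_ne_opp _ _ ((T.vert_next d').trans hv.symm) hj
  have k1 : cornerWeight 1 z = 0 ∨ T.next d' = d := by
    by_contra! h1
    obtain ⟨j, hj⟩ := key 1 h1.1
    rcases ZMod.four_cases j with rfl | rfl | rfl | rfl
    · rw [corner_zero, ← hv, ← corner_zero] at hj
      exact absurd (T.corner_injective d hj) (by decide)
    · exact hne (T.edge_injective _ _ hv hj.symm)
    · exact T.edge_ne_opp _ _ hv hj.symm
    · rw [corner_three] at hj
      exact h1.2 (T.edge_injective _ _ ((T.vert_next d').trans hv.symm) hj)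
  have k3 : cornerWeight 3 z = 0 ∨ T.next d = d' := by
    by_contra! h1
    obtain ⟨j, hj⟩ := key 3 h1.1
    rcases ZMod.four_cases j with rfl | rfl | rfl | rfl
    · rw [corner_zero, ← hv, ← corner_zero] at hj
      exact absurd (T.corner_injective d hj) (by decide)
    · rw [corner_three] at hj
      exact h1.2 (T.edge_injective _ _ ((T.vert_next d).trans hv) hj.symm)
    · rw [corner_three] at hj
      exact T.edge_ne_opp _ _ ((T.vert_next d).trans hv) hj.symm
    · rw [corner_three, corner_three] at hj
      refine hne (T.next.injective (T.edge_injective _ _ ?_ hj.symm))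
      rw [T.vert_next, T.vert_next, hv]
  rw [cornerWeight_one] at k1
  rw [cornerWeight_two, mul_eq_zero, Set.Icc.coe_eq_zero, Set.Icc.coe_eq_zero] at k2
  rw [cornerWeight_three] at k3
  rcases k2 with h0 | h0
  · rw [h0] at k3 ⊢; simpa using k3
  · rw [h0] at k1 ⊢; simpa using k1

theorem glued_iff_cell_eq {d d' : S × ZMod 4} {z z' : I × I} (hv : T.vert d = T.vert d') :
    T.Glued d z d' z' ↔ T.cell d z = T.cell d' z' := by
  refine ⟨Glued.cell_eq T hv, fun h => ?_⟩
  rcases eq_or_ne d d' with rfl | hne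
  · exact .inl ⟨rfl, T.cell_injective d h⟩
  obtain ⟨h1, h2, h3⟩ := T.axis_of_cell_eq hv hne h
  rcases eq_or_ne z 0 with rfl | hz
  · refine .inr (.inl ⟨rfl, ?_⟩)
    rw [show (0 : I × I) = (0, 0) from rfl, T.cell_zero hv] at h
    exact (T.cell_injective d' h).symm
  rcases h3 with h0 | h0
  · have h2 := h2.resolve_left fun h' => hz (Prod.ext h0 h')
    subst h2
    obtain ⟨x, y⟩ := z
    dsimp only at h0
    subst h0
    rw [T.cell_next] at h
    obtain rfl := T.cell_injective _ h
    exact .inr (.inr (.inl ⟨rfl, rfl, rfl, rfl⟩))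
  · have h1 := h1.resolve_left fun h' => hz (Prod.ext h' h0)
    subst h1
    obtain ⟨x, y⟩ := z
    dsimp only at h0
    subst h0
    rw [← T.cell_next] at h
    obtain rfl := T.cell_injective _ h
    exact .inr (.inr (.inr ⟨rfl, rfl, rfl, rfl⟩))

end QuadMap

/-! ### Comparing quotients of the same space. -/

theorem isQuotientMap_restrict {A Z : Type*} [TopologicalSpace A] [TopologicalSpace Z] {k : A → Z}
    (hk : Continuous k) (hk' : IsClosedMap k) {P : Set Z} (hP : ∀ x ∈ P, ∃ a, k a = x) (W : Set A)
    (hW : W = k ⁻¹' P) (hWP : ∀ a ∈ W, k a ∈ P) :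
    IsQuotientMap fun a : W => (⟨k a, hWP a a.2⟩ : P) := by
  subst hW
  refine (hk'.restrictPreimage P).isQuotientMap hk.restrictPreimage ?_
  rintro ⟨x, hx⟩
  obtain ⟨a, rfl⟩ := hP x hx
  exact ⟨⟨a, hx⟩, rfl⟩

/-- Two proper quotient maps with the same kernel have homeomorphic targets, also over subsets of
the targets that have the same preimage. -/
theorem exists_homeomorph_of_ker_eq {A X Y : Type*} [TopologicalSpace A] [TopologicalSpace X]
    [TopologicalSpace Y] {f : A → X} {g : A → Y} (hf : Continuous f) (hf' : IsClosedMap f)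
    (hg : Continuous g) (hg' : IsClosedMap g) {O : Set X} {U : Set Y} (hOU : f ⁻¹' O = g ⁻¹' U)
    (hO : ∀ x ∈ O, ∃ a, f a = x) (hU : ∀ y ∈ U, ∃ a, g a = y)
    (hker : ∀ a b, f a = f b ↔ g a = g b) :
    ∃ h : O ≃ₜ U, ∀ a (ha : f a ∈ O), (h ⟨f a, ha⟩ : Y) = g a := by
  have hm (a : A) : f a ∈ O ↔ g a ∈ U := Set.ext_iff.1 hOU a
  have qf := isQuotientMap_restrict hf hf' hO (f ⁻¹' O) rfl fun a ha => ha
  have qg := isQuotientMap_restrict hg hg' hU (f ⁻¹' O) hOU fun a ha => (hm a).1 ha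
  choose a ha using hO
  choose b hb using hU
  let φ : O → U := fun x => ⟨g (a x x.2), (hm _).1 (by rw [ha]; exact x.2)⟩
  let ψ : U → O := fun y => ⟨f (b y y.2), (hm _).2 (by rw [hb]; exact y.2)⟩
  have hφ (c : A) (hc : f c ∈ O) : φ ⟨f c, hc⟩ = ⟨g c, (hm c).1 hc⟩ :=
    Subtype.ext ((hker _ _).1 (ha _ _))
  have hψ (c : A) (hc : g c ∈ U) : ψ ⟨g c, hc⟩ = ⟨f c, (hm c).2 hc⟩ :=
    Subtype.ext ((hker _ _).2 (hb _ _))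
  refine ⟨⟨⟨φ, ψ, fun x => ?_, fun y => ?_⟩, ?_, ?_⟩, fun c hc => congrArg Subtype.val (hφ c hc)⟩
  · obtain ⟨c, rfl⟩ := qf.surjective x
    dsimp only
    rw [hφ, hψ]
  · obtain ⟨c, rfl⟩ := qg.surjective y
    dsimp only
    rw [hψ, hφ]
  · refine qf.continuous_iff.2 (qg.continuous.congr fun c => ?_)
    exact (hφ c c.2).symm
  · refine qg.continuous_iff.2 (qf.continuous.congr fun c => ?_)
    exact (hψ c _).symm

/-! ### The m-th root on a quadrant and the planar model of a cone. -/

/-- The point of the complex plane with the given coordinates. -/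
noncomputable def squarePoint (z : I × I) : ℂ := ((z.1 : ℝ) : ℂ) + ((z.2 : ℝ) : ℂ) * Complex.I

theorem squarePoint_re (z : I × I) : (squarePoint z).re = z.1 := by simp [squarePoint]

theorem squarePoint_im (z : I × I) : (squarePoint z).im = z.2 := by simp [squarePoint]

theorem squarePoint_injective : Function.Injective squarePoint := fun z z' h =>
  Prod.ext (Subtype.ext (by rw [← squarePoint_re, h, squarePoint_re]))
    (Subtype.ext (by rw [← squarePoint_im, h, squarePoint_im]))

theorem squarePoint_zero : squarePoint 0 = 0 := by simp [squarePoint]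

theorem squarePoint_eq_zero {z : I × I} : squarePoint z = 0 ↔ z = 0 := by
  rw [← squarePoint_zero, squarePoint_injective.eq_iff]

theorem continuous_squarePoint : Continuous squarePoint := by
  unfold squarePoint; fun_prop

/-- The principal `m`-th root on the first quadrant. -/
noncomputable def sectorRoot (m : ℕ) (z : I × I) : ℂ := squarePoint z ^ ((m : ℂ)⁻¹)

theorem sectorRoot_pow {m : ℕ} (hm : m ≠ 0) (z : I × I) : sectorRoot m z ^ m = squarePoint z :=
  Complex.cpow_nat_inv_pow _ hm

theorem sectorRoot_ne_zero {m : ℕ} (hm : m ≠ 0) {z : I × I} (hz : z ≠ 0) :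
    sectorRoot m z ≠ 0 := fun h => hz <| by
  rw [← squarePoint_eq_zero, ← sectorRoot_pow hm, h, zero_pow hm]

theorem sectorRoot_zero {m : ℕ} (hm : m ≠ 0) : sectorRoot m 0 = 0 :=
  eq_zero_of_pow_eq_zero (n := m) <| by rw [sectorRoot_pow hm, squarePoint_zero]

theorem continuous_sectorRoot {m : ℕ} (hm : m ≠ 0) : Continuous (sectorRoot m) := by
  refine continuous_iff_continuousAt.2 fun z => ?_
  refine ContinuousAt.comp (g := fun w : ℂ => w ^ ((m : ℂ)⁻¹)) ?_ continuous_squarePoint.continuousAt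
  -- The square lies in the closed right half plane, away from the branch cut except at 0; there
  -- continuity comes from the positive exponent.
  refine Complex.continuousAt_cpow_const_of_re_pos (.inl ?_) ?_
  · rw [squarePoint_re]; exact z.1.2.1
  · rw [← Complex.ofReal_natCast, ← Complex.ofReal_inv, Complex.ofReal_re]
    positivity

/-- The standard primitive root of unity of order `4 * m`. -/
noncomputable def sectorAngle (m : ℕ) : ℂ := Complex.exp (2 * Real.pi * Complex.I / (4 * m : ℕ))

theorem isPrimitiveRoot_sectorAngle {m : ℕ} (hm : m ≠ 0) :
    IsPrimitiveRoot (sectorAngle m) (4 * m) :=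
  Complex.isPrimitiveRoot_exp _ (by positivity)

theorem sectorAngle_ne_zero (m : ℕ) : sectorAngle m ≠ 0 := Complex.exp_ne_zero _

theorem sectorAngle_pow {m : ℕ} (hm : m ≠ 0) : sectorAngle m ^ m = Complex.I := by
  have : (m : ℂ) ≠ 0 := Nat.cast_ne_zero.2 hm
  rw [sectorAngle, ← Complex.exp_nat_mul]
  refine (congrArg Complex.exp ?_).trans Complex.exp_pi_div_two_mul_I
  push_cast
  field_simp
  ring

/-- The root divides the angle π/2 between the two axes by m, leaving 2π/(4m). -/
theorem sectorRoot_imaginary {m : ℕ} (hm : m ≠ 0) (t : I) :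
    sectorRoot m (0, t) = sectorAngle m * sectorRoot m (t, 0) := by
  rcases eq_or_ne t 0 with rfl | ht
  · change sectorRoot m 0 = _ * sectorRoot m 0
    rw [sectorRoot_zero hm, mul_zero]
  have hpos : 0 < (t : ℝ) := unitInterval.pos_iff_ne_zero.2 ht
  have h0 : ((t : ℝ) : ℂ) ≠ 0 := Complex.ofReal_ne_zero.2 hpos.ne'
  have hm' : (m : ℂ) ≠ 0 := Nat.cast_ne_zero.2 hm
  have e1 : squarePoint (0, t) = (t : ℝ) * Complex.I := by simp [squarePoint]
  have e2 : squarePoint (t, 0) = (t : ℝ) := by simp [squarePoint]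
  rw [sectorRoot, sectorRoot, e1, e2, Complex.cpow_def_of_ne_zero (mul_ne_zero h0 Complex.I_ne_zero),
    Complex.cpow_def_of_ne_zero h0, sectorAngle, ← Complex.exp_add,
    Complex.log_ofReal_mul hpos Complex.I_ne_zero, Complex.log_I, ← Complex.ofReal_log hpos.le]
  congr 1
  push_cast
  field_simp
  ring

/-- Closed quadrants overlap only along axes. If the rotations differ, the first alternative occurs
only at the origin. -/
theorem I_pow_val_mul_eq {a b : ZMod 4} {z z' : I × I}
    (h : Complex.I ^ a.val * squarePoint z = Complex.I ^ b.val * squarePoint z') :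
    z = z' ∨ (z.1 = 0 ∧ z'.2 = 0 ∧ z.2 = z'.1) ∨ (z'.1 = 0 ∧ z.2 = 0 ∧ z'.2 = z.1) := by
  obtain ⟨⟨x, hx⟩, ⟨y, hy⟩⟩ := z
  obtain ⟨⟨x', hx'⟩, ⟨y', hy'⟩⟩ := z'
  have v0 : (0 : ZMod 4).val = 0 := rfl
  have v1 : (1 : ZMod 4).val = 1 := rfl
  have v2 : (2 : ZMod 4).val = 2 := rfl
  have v3 : (3 : ZMod 4).val = 3 := rfl
  have c3 : Complex.I ^ 3 = -Complex.I := Complex.I_pow_three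
  simp only [Prod.mk.injEq, ← Subtype.coe_inj, Set.Icc.coe_zero]
  have hx0 := hx.1
  have hy0 := hy.1
  have hx0' := hx'.1
  have hy0' := hy'.1
  rcases ZMod.four_cases a with rfl | rfl | rfl | rfl <;>
  rcases ZMod.four_cases b with rfl | rfl | rfl | rfl <;>
  simp [v0, v1, v2, v3, c3, squarePoint, Complex.ext_iff] at h <;>
  grind

theorem I_pow_val_mul_mem_box (a : ZMod 4) (z : I × I) :
    |(Complex.I ^ a.val * squarePoint z).re| < 1 ∧ |(Complex.I ^ a.val * squarePoint z).im| < 1 ↔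
      (z.1 : ℝ) < 1 ∧ (z.2 : ℝ) < 1 := by
  have v0 : (0 : ZMod 4).val = 0 := rfl
  have v1 : (1 : ZMod 4).val = 1 := rfl
  have v2 : (2 : ZMod 4).val = 2 := rfl
  have v3 : (3 : ZMod 4).val = 3 := rfl
  have c3 : Complex.I ^ 3 = -Complex.I := Complex.I_pow_three
  have h1 : |(z.1 : ℝ)| = z.1 := abs_of_nonneg z.1.2.1
  have h2 : |(z.2 : ℝ)| = z.2 := abs_of_nonneg z.2.2.1
  rcases ZMod.four_cases a with rfl | rfl | rfl | rfl <;>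
  simp [v0, v1, v2, v3, c3, squarePoint_re, squarePoint_im, h1, h2, and_comm]

/-- The image of a vertex chart. -/
def chartRegion (m : ℕ) : Set ℂ := {w | |(w ^ m).re| < 1 ∧ |(w ^ m).im| < 1}

theorem isOpen_chartRegion (m : ℕ) : IsOpen (chartRegion m) := by
  have h1 : Continuous fun w : ℂ => |(w ^ m).re| := by fun_prop
  have h2 : Continuous fun w : ℂ => |(w ^ m).im| := by fun_prop
  exact (isOpen_lt h1 continuous_const).inter (isOpen_lt h2 continuous_const)

theorem exists_I_pow_mul_squarePoint {w : ℂ} (h1 : |w.re| < 1) (h2 : |w.im| < 1) :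
    ∃ (a : ℕ) (z : I × I), Complex.I ^ a * squarePoint z = w := by
  obtain ⟨h1, h1'⟩ := abs_lt.1 h1
  obtain ⟨h2, h2'⟩ := abs_lt.1 h2
  rcases le_total 0 w.re with hr | hr <;> rcases le_total 0 w.im with hi | hi
  · exact ⟨0, (⟨w.re, by linarith, by linarith⟩, ⟨w.im, by linarith, by linarith⟩), by
      apply Complex.ext <;> simp [squarePoint]⟩
  · exact ⟨3, (⟨-w.im, by linarith, by linarith⟩, ⟨w.re, by linarith, by linarith⟩), by
      apply Complex.ext <;> simp [squarePoint, Complex.I_pow_three]⟩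
  · exact ⟨1, (⟨w.im, by linarith, by linarith⟩, ⟨-w.re, by linarith, by linarith⟩), by
      apply Complex.ext <;> simp [squarePoint]⟩
  · exact ⟨2, (⟨-w.re, by linarith, by linarith⟩, ⟨-w.im, by linarith, by linarith⟩), by
      apply Complex.ext <;> simp [squarePoint]⟩

/-- The m-th power of `w` lies in some rotated quadrant, which yields a candidate with the same m-th
power; the quotient is an m-th root of unity, a power of `sectorAngle m ^ 4`. -/
theorem exists_sectorAngle_pow_mul_sectorRoot {m : ℕ} (hm : m ≠ 0) {w : ℂ}
    (hw : w ∈ chartRegion m) :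
    ∃ (k : ℕ) (z : I × I), sectorAngle m ^ k * sectorRoot m z = w := by
  obtain ⟨a, z, hz⟩ := exists_I_pow_mul_squarePoint hw.1 hw.2
  have hpow : (sectorAngle m ^ a * sectorRoot m z) ^ m = w ^ m := by
    rw [mul_pow, sectorRoot_pow hm, pow_right_comm, sectorAngle_pow hm, hz]
  rcases eq_or_ne (sectorAngle m ^ a * sectorRoot m z) 0 with h0 | h0
  · refine ⟨a, z, ?_⟩
    rw [h0, zero_pow hm] at hpow
    rw [h0, eq_zero_of_pow_eq_zero hpow.symm]
  · have : NeZero m := ⟨hm⟩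
    have hprim : IsPrimitiveRoot (sectorAngle m ^ 4) m :=
      (isPrimitiveRoot_sectorAngle hm).pow (by positivity) rfl
    obtain ⟨i, -, hi⟩ := hprim.eq_pow_of_pow_eq_one
      (ξ := w / (sectorAngle m ^ a * sectorRoot m z)) (by
        rw [div_pow, hpow, div_self]
        rw [← hpow]
        exact pow_ne_zero _ h0)
    refine ⟨4 * i + a, z, ?_⟩
    rw [pow_add, pow_mul, hi, mul_assoc, div_mul_cancel₀ _ h0]

/-! ### Angles of the flags around a vertex. -/

theorem Equiv.Perm.zpow_apply_snd {S : Type*} {N : ℕ} {f : Equiv.Perm (S × ZMod N)}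
    (hf : ∀ d, (f d).2 = d.2 + 1) (k : ℤ) (d : S × ZMod N) : ((f ^ k) d).2 = d.2 + k := by
  induction k with
  | zero => simp
  | succ n ih =>
    rw [add_comm, zpow_add, zpow_one, Equiv.Perm.mul_apply, hf, ih]
    push_cast; ring
  | pred n ih =>
    have h := hf ((f ^ (-(n : ℤ) - 1)) d)
    rw [← Equiv.Perm.mul_apply, ← zpow_one_add, add_sub_cancel, ih] at h
    push_cast at h ⊢
    linear_combination -h

theorem Equiv.Perm.apply_zpow_apply {D V : Type*} {f : Equiv.Perm D} {g : D → V}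
    (hg : ∀ d, g (f d) = g d) (k : ℤ) (d : D) : g ((f ^ k) d) = g d := by
  induction k with
  | zero => simp
  | succ n ih => rw [add_comm, zpow_add, zpow_one, Equiv.Perm.mul_apply, hg, ih]
  | pred n ih =>
    rw [← hg, ← Equiv.Perm.mul_apply, ← zpow_one_add, add_sub_cancel, ih]

namespace QuadMap

variable {S V : Type} {m : ℕ} (T : QuadMap S V m)

/-- Count the rotations from a base flag at each vertex. The count is defined modulo 4m, so it is an
exponent of a primitive 4m-th root of unity; base flags with second component 0 make it congruent to
`d.2` modulo 4. -/
theorem exists_flagAngle (hm : m ≠ 0) : ∃ u : S × ZMod 4 → ℂ,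
    (∀ d, u (T.next d) = sectorAngle m * u d) ∧
    (∀ d d', T.vert d = T.vert d' → u d = u d' → d = d') ∧
    ∀ d, u d ^ m = Complex.I ^ d.2.val := by
  have hbase (v : V) : ∃ d, T.vert d = v ∧ d.2 = 0 := by
    obtain ⟨d, hd⟩ := T.vert_surjective v
    refine ⟨(T.next ^ (-(d.2.val : ℤ))) d, by rw [Equiv.Perm.apply_zpow_apply T.vert_next, hd], ?_⟩
    rw [Equiv.Perm.zpow_apply_snd T.next_snd]
    simp
  choose b hb hb0 using hbase
  choose k hk using fun d => T.exists_zpow (b (T.vert d)) d (hb _)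
  have hprim := isPrimitiveRoot_sectorAngle hm
  have hdvd (i j : ℤ) (d : S × ZMod 4) (h : (T.next ^ i) d = (T.next ^ j) d) :
      ((4 * m : ℕ) : ℤ) ∣ i - j := by
    push_cast
    rw [← T.zpow_eq_self_iff d, sub_eq_neg_add, zpow_add, Equiv.Perm.mul_apply, h,
      ← Equiv.Perm.mul_apply, ← zpow_add, neg_add_cancel, zpow_zero, Equiv.Perm.one_apply]
  have hz (i j : ℤ) : ((4 * m : ℕ) : ℤ) ∣ i - j ↔ sectorAngle m ^ i = sectorAngle m ^ j := by
    rw [← hprim.zpow_eq_one_iff_dvd, zpow_sub₀ (sectorAngle_ne_zero m),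
      div_eq_one_iff_eq (zpow_ne_zero _ (sectorAngle_ne_zero m))]
  refine ⟨fun d => sectorAngle m ^ k d, fun d => ?_, fun d d' hv h => ?_, fun d => ?_⟩
  · rw [← zpow_one_add₀ (sectorAngle_ne_zero m)]
    refine (hz _ _).1 (hdvd _ _ (b (T.vert d)) ?_)
    have h1 := hk (T.next d)
    rw [T.vert_next] at h1
    rw [h1, zpow_one_add, Equiv.Perm.mul_apply, hk]
  · have h1 := (hz _ _).2 h
    push_cast at h1
    rw [← T.zpow_eq_self_iff d'] at h1
    have h2 := hk d
    have h3 := hk d'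
    rw [hv] at h2
    generalize b (T.vert d') = e at h2 h3
    rw [← h2, ← h1, ← Equiv.Perm.inv_eq_iff_eq.2 h3.symm, ← zpow_neg, ← Equiv.Perm.mul_apply,
      ← zpow_add, sub_eq_add_neg]
  · have h2 := congrArg Prod.snd (hk d)
    rw [Equiv.Perm.zpow_apply_snd T.next_snd, hb0, zero_add] at h2
    rw [← zpow_natCast, ← zpow_mul, mul_comm, zpow_mul, zpow_natCast, sectorAngle_pow hm, ← h2,
      ← zpow_natCast, ZMod.val_intCast]
    -- Since I has order 4, only the remainder of `k d` modulo 4 matters.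
    conv_lhs => rw [← Int.emod_add_mul_ediv (k d) 4]
    rw [zpow_add₀ Complex.I_ne_zero, zpow_mul]
    norm_num [zpow_ofNat]

/-- The planar counterpart of `glued_iff_cell_eq`: both maps identify the same points, so their
images are homeomorphic. Taking m-th powers locates the coincidences, and the angles then identify
the flags. -/
theorem glued_iff_flagAngle (hm : m ≠ 0) {u : S × ZMod 4 → ℂ}
    (hu : ∀ d, u (T.next d) = sectorAngle m * u d)
    (huinj : ∀ d d', T.vert d = T.vert d' → u d = u d' → d = d')
    (hupow : ∀ d, u d ^ m = Complex.I ^ d.2.val) {d d' : S × ZMod 4} {z z' : I × I}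
    (hv : T.vert d = T.vert d') :
    T.Glued d z d' z' ↔ u d * sectorRoot m z = u d' * sectorRoot m z' := by
  obtain ⟨x, y⟩ := z
  obtain ⟨x', y'⟩ := z'
  constructor
  · rintro (⟨rfl, h⟩ | ⟨h, h'⟩ | ⟨rfl, h1, h2, h3⟩ | ⟨rfl, h1, h2, h3⟩)
    · rw [h]
    · rw [h, h', sectorRoot_zero hm, mul_zero, mul_zero]
    · dsimp only at h1 h2 h3; subst h1 h2 h3
      rw [sectorRoot_imaginary hm, hu]; ring
    · dsimp only at h1 h2 h3; subst h1 h2 h3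
      rw [sectorRoot_imaginary hm, hu]; ring
  · intro h
    have hp := congrArg (· ^ m) h
    simp only [mul_pow, hupow, sectorRoot_pow hm] at hp
    rcases I_pow_val_mul_eq hp with heq | ⟨h1, h2, h3⟩ | ⟨h1, h2, h3⟩
    · rw [heq] at h ⊢
      by_cases h0 : (x', y') = 0
      · exact .inr (.inl ⟨h0, h0⟩)
      · exact .inl ⟨huinj _ _ hv (mul_right_cancel₀ (sectorRoot_ne_zero hm h0) h), rfl⟩
    · dsimp only at h1 h2 h3; subst h1 h2 h3
      by_cases h0 : y = 0
      · subst h0; exact .inr (.inl ⟨rfl, rfl⟩)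
      · refine .inr (.inr (.inl ⟨huinj _ _ ((T.vert_next d).trans hv) ?_, rfl, rfl, rfl⟩))
        refine mul_right_cancel₀ (sectorRoot_ne_zero hm (z := (y, 0)) fun h' => h0 ?_) ?_
        · exact congrArg Prod.fst h'
        · rw [← h, sectorRoot_imaginary hm, hu]; ring
    · dsimp only at h1 h2 h3; subst h1 h2 h3
      by_cases h0 : y' = 0
      · subst h0; exact .inr (.inl ⟨rfl, rfl⟩)
      · refine .inr (.inr (.inr ⟨huinj _ _ ((T.vert_next d').trans hv.symm) ?_, rfl, rfl, rfl⟩))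
        refine mul_right_cancel₀ (sectorRoot_ne_zero hm (z := (y', 0)) fun h' => h0 ?_) ?_
        · exact congrArg Prod.fst h'
        · rw [h, sectorRoot_imaginary hm, hu]; ring

/-! ### The surface and its vertex charts. -/

/-- The realization of the surface in the space spanned by the vertices. -/
def carrier : Set (V → ℝ) := ⋃ d, range (T.cell d)

/-- The surface tiled by the squares. -/
abbrev Surface : Type := T.carrier

/-- The parametrization of the square of the flag `d`. -/
noncomputable def square (d : S × ZMod 4) (z : I × I) : T.Surface :=
  ⟨T.cell d z, mem_iUnion.2 ⟨d, z, rfl⟩⟩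

theorem continuous_square (d : S × ZMod 4) : Continuous (T.square d) :=
  (T.continuous_cell d).subtype_mk _

theorem square_injective (d : S × ZMod 4) : Function.Injective (T.square d) := fun _ _ h =>
  T.cell_injective d (congrArg Subtype.val h)

theorem exists_square (p : T.Surface) : ∃ d z, T.square d z = p := by
  obtain ⟨d, z, h⟩ := mem_iUnion.1 p.2
  exact ⟨d, z, Subtype.ext h⟩

theorem glued_iff_square_eq {d d' : S × ZMod 4} {z z' : I × I} (hv : T.vert d = T.vert d') :
    T.Glued d z d' z' ↔ T.square d z = T.square d' z' := by
  rw [T.glued_iff_cell_eq hv]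
  exact (Subtype.ext_iff (a1 := T.square d z) (a2 := T.square d' z')).symm

/-- The open star of a vertex. -/
def star (v : V) : Set T.Surface := {p | p.1 v ≠ 0}

theorem isOpen_star (v : V) : IsOpen (T.star v) :=
  isOpen_ne_fun ((continuous_apply v).comp continuous_subtype_val) continuous_const

/-- Planar coordinates of a point of a square, independent of the corner used as an origin. -/
noncomputable def planarPoint (r : ZMod 4) (z : I × I) : ℂ :=
  Complex.I ^ r.val * squarePoint z +
    (![0, 1, 1 + Complex.I, Complex.I] : Fin 4 → ℂ) r

theorem planarPoint_quarterTurn (r : ZMod 4) (z : I × I) :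
    planarPoint (r + 1) (quarterTurn z) = planarPoint r z := by
  have v0 : (0 : ZMod 4).val = 0 := rfl
  have v1 : (1 : ZMod 4).val = 1 := rfl
  have v2 : (2 : ZMod 4).val = 2 := rfl
  have v3 : (3 : ZMod 4).val = 3 := rfl
  have c3 : Complex.I ^ 3 = -Complex.I := Complex.I_pow_three
  rcases ZMod.four_cases r with rfl | rfl | rfl | rfl
  · change Complex.I ^ (1 : ZMod 4).val * _ + 1 = Complex.I ^ (0 : ZMod 4).val * _ + 0
    rw [v0, v1]
    apply Complex.ext <;> simp [squarePoint, quarterTurn]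
  · change Complex.I ^ (2 : ZMod 4).val * _ + (1 + Complex.I) = Complex.I ^ (1 : ZMod 4).val * _ + 1
    rw [v2, v1]
    apply Complex.ext <;> simp [squarePoint, quarterTurn]
  · change Complex.I ^ (3 : ZMod 4).val * _ + Complex.I =
      Complex.I ^ (2 : ZMod 4).val * _ + (1 + Complex.I)
    rw [v2, v3, c3]
    apply Complex.ext <;> simp [squarePoint, quarterTurn, sub_eq_neg_add]
  · change Complex.I ^ (0 : ZMod 4).val * _ + 0 = Complex.I ^ (3 : ZMod 4).val * _ + Complex.I
    rw [v0, v3, c3]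
    apply Complex.ext <;> simp [squarePoint, quarterTurn, sub_eq_neg_add]

theorem exists_square_eq (s : S) (r r' : ZMod 4) (z : I × I) :
    ∃ z', T.square (s, r') z' = T.square (s, r) z ∧ planarPoint r' z' = planarPoint r z := by
  have h (n : ℕ) : ∃ z', T.square (s, r + n) z' = T.square (s, r) z ∧
      planarPoint (r + n) z' = planarPoint r z := by
    induction n with
    | zero => exact ⟨z, by simp⟩
    | succ n ih =>
      obtain ⟨z', h1, h2⟩ := ih
      refine ⟨quarterTurn z', ?_, ?_⟩
      · rw [← h1, Nat.cast_succ, ← add_assoc]; exact Subtype.ext (T.cell_quarterTurn _ _ _)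
      · rw [← h2, Nat.cast_succ, ← add_assoc, planarPoint_quarterTurn]
  simpa using h (r' - r).val

theorem exists_flag_of_mem_star {s : S} {r : ZMod 4} {z : I × I} {v : V}
    (h : T.square (s, r) z ∈ T.star v) : ∃ r', T.vert (s, r') = v := by
  obtain ⟨j, hj, -⟩ := T.exists_corner_of_cell_ne_zero h
  exact ⟨_, hj⟩

/-- The star and the planar region are quotients of the same part of the disjoint union of the
squares at `v`. The m-th power of the chart is the flat coordinate of each square centred at `v`. -/
theorem exists_chart [Finite S] (hm : m ≠ 0) (v : V) : ∃ h : T.star v ≃ₜ chartRegion m,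
    ∀ (d : S × ZMod 4) (z : I × I) (hz : T.square d z ∈ T.star v), T.vert d = v →
      (h ⟨T.square d z, hz⟩ : ℂ) ^ m = Complex.I ^ d.2.val * squarePoint z := by
  obtain ⟨u, hu, huinj, hupow⟩ := T.exists_flagAngle hm
  let f : (Σ _ : {d : S × ZMod 4 // T.vert d = v}, I × I) → T.Surface := fun a => T.square a.1 a.2
  let g : (Σ _ : {d : S × ZMod 4 // T.vert d = v}, I × I) → ℂ :=
    fun a => u a.1 * sectorRoot m a.2
  have hf : Continuous f := continuous_sigma fun d => T.continuous_square d
  have hg : Continuous g := continuous_sigma fun d =>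
    (continuous_const (y := u d)).mul (continuous_sectorRoot hm)
  have hgpow (a) : g a ^ m = Complex.I ^ a.1.1.2.val * squarePoint a.2 := by
    rw [mul_pow, hupow, sectorRoot_pow hm]
  refine (exists_homeomorph_of_ker_eq hf hf.isClosedMap hg hg.isClosedMap (O := T.star v)
    (U := chartRegion m) ?_ ?_ ?_ ?_).imp fun h hh d z hz hd => by
      rw [hh ⟨⟨d, hd⟩, z⟩ hz, hgpow]
  -- The coordinate at `v` is (1 - x)(1 - y), so the star is x, y < 1, which is the open box for the
  -- m-th power.
  · ext a
    have hle1 : (a.2.1 : ℝ) ≤ 1 := a.2.1.2.2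
    have hle2 : (a.2.2 : ℝ) ≤ 1 := a.2.2.2.2
    simp only [mem_preimage, chartRegion, Set.mem_ofPred_eq, hgpow, I_pow_val_mul_mem_box]
    change T.cell a.1.1 a.2 v ≠ 0 ↔ _
    rw [T.cell_vert a.1.2, mul_ne_zero_iff, sub_ne_zero, sub_ne_zero, ne_comm, ne_comm (a := (1:ℝ)),
      lt_iff_le_and_ne, lt_iff_le_and_ne]
    tauto
  · intro p hp
    obtain ⟨⟨s, r⟩, z, rfl⟩ := T.exists_square p
    obtain ⟨r', hr'⟩ := T.exists_flag_of_mem_star hp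
    obtain ⟨z', hz', -⟩ := T.exists_square_eq s r r' z
    exact ⟨⟨⟨(s, r'), hr'⟩, z'⟩, hz'⟩
  · intro w hw
    obtain ⟨d, rfl⟩ := T.vert_surjective v
    have hud : u d ≠ 0 := fun h0 => by
      have := hupow d
      rw [h0, zero_pow hm] at this
      exact pow_ne_zero _ Complex.I_ne_zero this.symm
    have hpow (k : ℕ) : ∃ d', T.vert d' = T.vert d ∧ u d' = sectorAngle m ^ k * u d := by
      induction k with
      | zero => exact ⟨d, rfl, by simp⟩
      | succ k ih =>
        obtain ⟨d', h1, h2⟩ := ih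
        exact ⟨T.next d', (T.vert_next d').trans h1, by rw [hu, h2, pow_succ]; ring⟩
    -- Dividing by `u d` turns the m-th power by a multiple of a right angle, which preserves the
    -- box.
    obtain ⟨r, hr⟩ : ∃ r : ZMod 4, Complex.I ^ r.val * u d ^ m = 1 := by
      refine ⟨-d.2, ?_⟩
      rw [hupow]
      rcases ZMod.four_cases d.2 with h | h | h | h <;> rw [h]
      · simp
      · change Complex.I ^ 3 * Complex.I ^ 1 = 1; rw [← pow_add]; norm_num
      · change Complex.I ^ 2 * Complex.I ^ 2 = 1; rw [← pow_add]; norm_num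
      · change Complex.I ^ 1 * Complex.I ^ 3 = 1; rw [← pow_add]; norm_num
    have hw' : w / u d ∈ chartRegion m := by
      have e : (w / u d) ^ m = Complex.I ^ r.val * w ^ m := by
        rw [div_pow, div_eq_iff (pow_ne_zero _ hud), mul_right_comm, hr, one_mul]
      have hz' := hw
      simp only [chartRegion, Set.mem_ofPred_eq, e] at hz' ⊢
      have v0 : (0 : ZMod 4).val = 0 := rfl
      have v1 : (1 : ZMod 4).val = 1 := rfl
      have v2 : (2 : ZMod 4).val = 2 := rfl
      have v3 : (3 : ZMod 4).val = 3 := rfl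
      rcases ZMod.four_cases r with rfl | rfl | rfl | rfl <;>
      simpa [v0, v1, v2, v3, Complex.I_pow_three, and_comm] using hz'
    obtain ⟨k, z, hz⟩ := exists_sectorAngle_pow_mul_sectorRoot hm hw'
    obtain ⟨d', h1, h2⟩ := hpow k
    refine ⟨⟨⟨d', h1⟩, z⟩, ?_⟩
    change u d' * sectorRoot m z = w
    rw [h2, mul_right_comm, hz, div_mul_cancel₀ _ hud]
  · rintro ⟨⟨d, hd⟩, z⟩ ⟨⟨d', hd'⟩, z'⟩
    have hv := hd.trans hd'.symm
    exact (T.glued_iff_square_eq hv).symm.trans (T.glued_iff_flagAngle hm hu huinj hupow hv)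

end QuadMap

/-! ### Complex analysis of the transition maps. -/

/-- The coordinates identifying the complex plane with the model of surfaces. -/
noncomputable def planeEquiv : ℂ ≃L[ℝ] EuclideanSpace ℝ (Fin 2) :=
  Complex.orthonormalBasisOneI.repr.toContinuousLinearEquiv

theorem det_conj_planeEquiv (a : ℂ) :
    ((planeEquiv : ℂ →L[ℝ] EuclideanSpace ℝ (Fin 2)).comp
      (((ContinuousLinearMap.toSpanSingleton ℂ a).restrictScalars ℝ).comp
        (planeEquiv.symm : EuclideanSpace ℝ (Fin 2) →L[ℝ] ℂ))).det = Complex.normSq a := by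
  have h := LinearMap.det_conj (LinearMap.mul ℝ ℂ a) planeEquiv.toLinearEquiv
  have h' : LinearMap.det (LinearMap.mul ℝ ℂ a) = Complex.normSq a := by
    change Algebra.norm ℝ a = _
    rw [Algebra.norm_complex_eq]; rfl
  rw [← h', ← h, ContinuousLinearMap.det]
  congr 1
  ext x
  simp [mul_comm]

/-- A locally biholomorphic map of the plane is smooth and orientation-preserving. -/
theorem contDiffOn_and_det_pos {f : ℂ → ℂ} {O : Set ℂ} (hO : IsOpen O)
    (hf : ∀ z ∈ O, ∃ a, a ≠ 0 ∧ HasDerivAt f a z) :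
    ContDiffOn ℝ ∞ (planeEquiv ∘ f ∘ planeEquiv.symm) (planeEquiv.symm ⁻¹' O) ∧
      ∀ x ∈ planeEquiv.symm ⁻¹' O,
        0 < (fderiv ℝ (planeEquiv ∘ f ∘ planeEquiv.symm) x).det := by
  constructor
  · have h : DifferentiableOn ℂ f O := fun z hz => by
      obtain ⟨a, -, ha⟩ := hf z hz
      exact ha.differentiableAt.differentiableWithinAt
    have h' : ContDiffOn ℝ ∞ f O := (h.contDiffOn hO).restrict_scalars ℝ
    exact planeEquiv.contDiff.comp_contDiffOn
      (h'.comp planeEquiv.symm.contDiff.contDiffOn fun x hx => hx)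
  · intro x hx
    obtain ⟨a, ha0, ha⟩ := hf _ hx
    have h := (planeEquiv.hasFDerivAt (x := f (planeEquiv.symm x))).comp x
      ((ha.hasFDerivAt.restrictScalars ℝ).comp x (planeEquiv.symm.hasFDerivAt (x := x)))
    rw [h.fderiv]
    refine lt_of_lt_of_eq (Complex.normSq_pos.2 ha0) (det_conj_planeEquiv a).symm

theorem eventually_eq_of_finite_range {f : ℂ → ℂ} {O F : Set ℂ} (hO : IsOpen O)
    (hf : ContinuousOn f O) (hF : F.Finite) (hfF : ∀ z ∈ O, f z ∈ F) {z : ℂ} (hz : z ∈ O) :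
    ∀ᶠ w in 𝓝 z, f w = f z := by
  have h1 : ∀ᶠ w in 𝓝 z, f w ∈ (F \ {f z})ᶜ :=
    (hf.continuousAt (hO.mem_nhds hz)).eventually
      ((hF.subset sdiff_subset).isClosed.isOpen_compl.mem_nhds fun h => h.2 rfl)
  filter_upwards [h1, hO.mem_nhds hz] with w hw hwO
  by_contra hne
  exact hw ⟨hfF w hwO, hne⟩

/-- A continuous solution `f` of `f w ^ m = w ^ m + c` is locally biholomorphic away from the
zeros. -/
theorem exists_hasDerivAt_of_pow_eq {m : ℕ} (hm : m ≠ 0) {f : ℂ → ℂ} {z c : ℂ}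
    (hf : ContinuousAt f z) (hz : z ≠ 0) (hfz : f z ≠ 0)
    (h : ∀ᶠ w in 𝓝 z, f w ^ m = w ^ m + c) : ∃ a, a ≠ 0 ∧ HasDerivAt f a z := by
  have hg : HasStrictDerivAt (fun x : ℂ => x ^ m) (m * f z ^ (m - 1)) (f z) :=
    hasStrictDerivAt_pow m (f z)
  have hm' : (m : ℂ) ≠ 0 := Nat.cast_ne_zero.2 hm
  have hg0 : (m * f z ^ (m - 1) : ℂ) ≠ 0 := mul_ne_zero hm' (pow_ne_zero _ hfz)
  have hG := (hg.to_localInverse hg0).hasDerivAt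
  have hp : HasDerivAt (fun w : ℂ => w ^ m + c) (m * z ^ (m - 1)) z :=
    (hasDerivAt_pow m z).add_const c
  -- By continuity `f` stays on one branch, so it is the local inverse of the m-th power applied to
  -- `w ^ m + c`.
  have e1 : ∀ᶠ w in 𝓝 z, hg.localInverse _ _ _ hg0 (f w ^ m) = f w :=
    hf.eventually (hg.hasStrictFDerivAt_equiv hg0).eventually_left_inverse
  have hz' : f z ^ m = z ^ m + c := h.self_of_nhds
  simp only [hz'] at hG
  refine ⟨_, ?_, (HasDerivAt.comp z hG hp).congr_of_eventuallyEq ?_⟩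
  · exact mul_ne_zero (inv_ne_zero hg0) (mul_ne_zero hm' (pow_ne_zero _ hz))
  · filter_upwards [h, e1] with w h1 h2
    rw [Function.comp_apply, ← h1, h2]

/-! ### Two facts about the unit square. -/

theorem IsSquareFace.image_quarterTurn {F : Set (I × I)} (hF : IsSquareFace F) :
    IsSquareFace (quarterTurn '' F) := by
  rcases hF with rfl | ⟨A, B, hA, hB, rfl⟩
  · exact .inl (image_empty _)
  refine .inr ⟨B, unitInterval.symm '' A, hB, ?_, ?_⟩
  · rcases hA with rfl | rfl | rfl
    · simp
    · simp
    · right; right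
      exact image_univ_of_surjective unitInterval.symm_bijective.surjective
  · ext ⟨x, y⟩
    simp only [quarterTurn, mem_image, mem_prod, Prod.exists, Prod.mk.injEq]
    constructor
    · rintro ⟨a, b, ⟨ha, hb⟩, rfl, rfl⟩
      exact ⟨hb, a, ha, rfl⟩
    · rintro ⟨hb, a, ha, rfl⟩
      exact ⟨a, x, ⟨ha, hb⟩, rfl, rfl⟩

theorem exists_cornerWeight_ne_zero (z : I × I) : ∃ j, cornerWeight j z ≠ 0 := by
  by_contra! h
  have h0 := h 0
  have h1 := h 1
  have h2 := h 2
  have h3 := h 3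
  rw [cornerWeight_zero] at h0
  rw [cornerWeight_one] at h1
  rw [cornerWeight_two] at h2
  rw [cornerWeight_three] at h3
  linarith

/-! ### Compactness, connectedness and the oriented atlas. -/

namespace QuadMap

variable {S V : Type} {m : ℕ} (T : QuadMap S V m)

theorem compactSpace_surface [Finite S] : CompactSpace T.Surface :=
  isCompact_iff_compactSpace.1 <| isCompact_iUnion fun d => isCompact_range (T.continuous_cell d)

theorem range_square_eq (s : S) (r r' : ZMod 4) :
    range (T.square (s, r)) = range (T.square (s, r')) := by
  have h (r r' : ZMod 4) : range (T.square (s, r)) ⊆ range (T.square (s, r')) := by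
    rintro _ ⟨z, rfl⟩
    obtain ⟨z', hz', -⟩ := T.exists_square_eq s r r' z
    exact ⟨z', hz'⟩
  exact (h r r').antisymm (h r' r)

theorem iUnion_range_square : ⋃ s, range (T.square (s, 0)) = univ := by
  refine eq_univ_of_forall fun p => ?_
  obtain ⟨⟨s, r⟩, z, rfl⟩ := T.exists_square p
  refine mem_iUnion.2 ⟨s, ?_⟩
  rw [T.range_square_eq s 0 r]
  exact mem_range_self z

theorem connectedSpace_surface [Nonempty S] (h : ∀ s s', Relation.ReflTransGen
    (fun s s' => ∃ r r', T.vert (s, r) = T.vert (s', r')) s s') : ConnectedSpace T.Surface := by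
  have hpre : IsPreconnected (⋃ s, range (T.square (s, 0))) := by
    refine IsPreconnected.iUnion_of_reflTransGen
      (fun s => isPreconnected_range (T.continuous_square _)) fun s s' =>
      Relation.ReflTransGen.mono ?_ _ _ (h s s')
    rintro s s' ⟨r, r', hr⟩
    refine ⟨T.square (s, r) 0, ?_, ?_⟩
    · rw [T.range_square_eq s 0 r]; exact mem_range_self _
    · rw [T.range_square_eq s' 0 r', (T.glued_iff_square_eq hr).1 (.inr (.inl ⟨rfl, rfl⟩))]
      exact mem_range_self _
  rw [T.iUnion_range_square] at hpre
  have : Nonempty T.Surface := ⟨T.square (Classical.arbitrary S, 0) 0⟩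
  have : PreconnectedSpace T.Surface := ⟨hpre⟩
  exact ConnectedSpace.mk ‹_›

theorem nonempty_star (v : V) : Nonempty (T.star v) := by
  obtain ⟨d, rfl⟩ := T.vert_surjective v
  refine ⟨T.square d 0, ?_⟩
  change T.cell d 0 _ ≠ 0
  rw [T.cell_vert rfl]
  simp

theorem exists_mem_star (p : T.Surface) : ∃ v, p ∈ T.star v := by
  obtain ⟨d, z, rfl⟩ := T.exists_square p
  obtain ⟨j, hj⟩ := exists_cornerWeight_ne_zero z
  exact ⟨T.corner d j, by change T.cell d z _ ≠ 0; rwa [T.cell_corner]⟩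

section Charts

variable [Finite S] (hm : m ≠ 0)

/-- The chart around a vertex, as a homeomorphism. -/
noncomputable def vertexHomeo (v : V) : T.star v ≃ₜ chartRegion m :=
  (T.exists_chart hm v).choose

theorem vertexHomeo_pow (v : V) (d : S × ZMod 4) (z : I × I) (hz : T.square d z ∈ T.star v)
    (hd : T.vert d = v) :
    (T.vertexHomeo hm v ⟨T.square d z, hz⟩ : ℂ) ^ m = Complex.I ^ d.2.val * squarePoint z :=
  (T.exists_chart hm v).choose_spec d z hz hd

/-- The chart around a vertex. -/
noncomputable def vertexChart (v : V) : OpenPartialHomeomorph T.Surface ℂ :=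
  haveI := T.nonempty_star v
  ((T.isOpen_star v).isOpenEmbedding_subtypeVal.toOpenPartialHomeomorph _).symm.trans
    (((isOpen_chartRegion m).isOpenEmbedding_subtypeVal.comp
      (T.vertexHomeo hm v).isOpenEmbedding).toOpenPartialHomeomorph _)

theorem vertexChart_source (v : V) : (T.vertexChart hm v).source = T.star v := by
  simp [vertexChart]

theorem vertexChart_apply (v : V) {p : T.Surface} (hp : p ∈ T.star v) :
    T.vertexChart hm v p = T.vertexHomeo hm v ⟨p, hp⟩ := by
  have := T.nonempty_star v
  have h := (T.isOpen_star v).isOpenEmbedding_subtypeVal.toOpenPartialHomeomorph_left_inv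
    (x := ⟨p, hp⟩)
  change ((T.vertexHomeo hm v (((T.isOpen_star v).isOpenEmbedding_subtypeVal.toOpenPartialHomeomorph
    _).symm p) : chartRegion m) : ℂ) = _
  exact congrArg (fun q => ((T.vertexHomeo hm v q : chartRegion m) : ℂ)) h

theorem vertexChart_pow (v : V) {d : S × ZMod 4} {z : I × I} (hz : T.square d z ∈ T.star v)
    (hd : T.vert d = v) :
    T.vertexChart hm v (T.square d z) ^ m = Complex.I ^ d.2.val * squarePoint z := by
  rw [T.vertexChart_apply hm v hz, T.vertexHomeo_pow hm v d z hz hd]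

/-- Each m-th power is the planar coordinate of the square minus the position of a corner, so the
difference takes finitely many values. -/
theorem vertexChart_pow_sub {v v' : V} {p : T.Surface} (hp : p ∈ T.star v) (hp' : p ∈ T.star v') :
    T.vertexChart hm v' p ^ m - T.vertexChart hm v p ^ m ∈
      range fun r : ZMod 4 × ZMod 4 => (![0, 1, 1 + Complex.I, Complex.I] : Fin 4 → ℂ) r.1 -
        (![0, 1, 1 + Complex.I, Complex.I] : Fin 4 → ℂ) r.2 := by
  obtain ⟨⟨s, r₀⟩, z₀, rfl⟩ := T.exists_square p
  obtain ⟨r, hr⟩ := T.exists_flag_of_mem_star hp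
  obtain ⟨r', hr'⟩ := T.exists_flag_of_mem_star hp'
  obtain ⟨z, hz, hpz⟩ := T.exists_square_eq s r₀ r z₀
  obtain ⟨z', hz', hpz'⟩ := T.exists_square_eq s r₀ r' z₀
  refine ⟨(r, r'), ?_⟩
  have h1 := T.vertexChart_pow hm v (hz.symm ▸ hp) hr
  have h2 := T.vertexChart_pow hm v' (hz'.symm ▸ hp') hr'
  rw [hz] at h1
  rw [hz'] at h2
  rw [h1, h2]
  have h3 := hpz.trans hpz'.symm
  unfold planarPoint at h3
  dsimp only at h3 ⊢
  linear_combination h3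

/-- A chart vanishes only at its own vertex, which lies in no other star. -/
theorem vertexChart_ne_zero {v v' : V} (hne : v ≠ v') {p : T.Surface} (hp : p ∈ T.star v)
    (hp' : p ∈ T.star v') : T.vertexChart hm v p ≠ 0 := by
  intro h0
  obtain ⟨⟨s, r₀⟩, z₀, rfl⟩ := T.exists_square p
  obtain ⟨r, hr⟩ := T.exists_flag_of_mem_star hp
  obtain ⟨z, hz, -⟩ := T.exists_square_eq s r₀ r z₀
  rw [← hz] at hp hp' h0
  have h1 := T.vertexChart_pow hm v hp hr
  rw [h0, zero_pow hm, eq_comm, mul_eq_zero, squarePoint_eq_zero] at h1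
  have h2 := h1.resolve_left (pow_ne_zero _ Complex.I_ne_zero)
  subst h2
  obtain ⟨j, hj, hj'⟩ := T.exists_corner_of_cell_ne_zero hp'
  rcases ZMod.four_cases j with rfl | rfl | rfl | rfl
  · rw [corner_zero] at hj
    exact hne (hr.symm.trans hj)
  · simp [cornerWeight_one] at hj'
  · simp [cornerWeight_two] at hj'
  · simp [cornerWeight_three] at hj'

theorem exists_hasDerivAt_transition (v v' : V) {w : ℂ}
    (hw : w ∈ ((T.vertexChart hm v).symm.trans (T.vertexChart hm v')).source) :
    ∃ a, a ≠ 0 ∧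
      HasDerivAt ((T.vertexChart hm v).symm.trans (T.vertexChart hm v')) a w := by
  set e := T.vertexChart hm v with he
  set e' := T.vertexChart hm v' with he'
  set f := e.symm.trans e' with hf
  have hmem {x : ℂ} (hx : x ∈ f.source) : x ∈ e.target ∧ e.symm x ∈ T.star v ∧
      e.symm x ∈ T.star v' := by
    rw [hf, OpenPartialHomeomorph.trans_source, OpenPartialHomeomorph.symm_source] at hx
    refine ⟨hx.1, ?_, ?_⟩
    · rw [← T.vertexChart_source hm v]; exact e.map_target hx.1
    · rw [← T.vertexChart_source hm v']; exact hx.2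
  -- The root argument fails at the cone point, which only occurs in the overlap of a chart with
  -- itself; there the transition is the identity.
  by_cases hvv : v = v'
  · subst hvv
    refine ⟨1, one_ne_zero, (hasDerivAt_id w).congr_of_eventuallyEq ?_⟩
    filter_upwards [f.open_source.mem_nhds hw] with x hx
    exact e.right_inv (hmem hx).1
  have hpow : ∀ x ∈ f.source, f x ^ m - x ^ m ∈
      range fun r : ZMod 4 × ZMod 4 => (![0, 1, 1 + Complex.I, Complex.I] : Fin 4 → ℂ) r.1 -
        (![0, 1, 1 + Complex.I, Complex.I] : Fin 4 → ℂ) r.2 := fun x hx => by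
    obtain ⟨h1, h2, h3⟩ := hmem hx
    have h := T.vertexChart_pow_sub hm h2 h3
    rwa [← he, ← he', e.right_inv h1] at h
  have hcont : ContinuousOn (fun x => f x ^ m - x ^ m) f.source :=
    (f.continuousOn.pow m).sub (continuous_pow m).continuousOn
  have hev := eventually_eq_of_finite_range f.open_source hcont (finite_range _) hpow hw
  obtain ⟨h1, h2, h3⟩ := hmem hw
  refine exists_hasDerivAt_of_pow_eq hm (c := f w ^ m - w ^ m)
    (f.continuousOn.continuousAt (f.open_source.mem_nhds hw)) ?_ ?_ ?_
  · have := T.vertexChart_ne_zero hm hvv h2 h3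
    rwa [← he, e.right_inv h1] at this
  · exact T.vertexChart_ne_zero hm (Ne.symm hvv) h3 h2
  · filter_upwards [hev] with x hx
    rw [← hx]; ring

/-- The chart around a vertex, with values in the model of surfaces. -/
noncomputable def planeChart (v : V) :
    OpenPartialHomeomorph T.Surface (EuclideanSpace ℝ (Fin 2)) :=
  (T.vertexChart hm v).transHomeomorph planeEquiv.toHomeomorph

theorem planeChart_transition (v v' : V) :
    ContDiffOn ℝ ∞ ((T.planeChart hm v).symm.trans (T.planeChart hm v'))
      ((T.planeChart hm v).symm.trans (T.planeChart hm v')).source ∧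
    ∀ x ∈ ((T.planeChart hm v).symm.trans (T.planeChart hm v')).source,
      0 < (fderiv ℝ ((T.planeChart hm v).symm.trans (T.planeChart hm v')) x).det := by
  have h := contDiffOn_and_det_pos
    ((T.vertexChart hm v).symm.trans (T.vertexChart hm v')).open_source
    fun w hw => T.exists_hasDerivAt_transition hm v v' hw
  have hs : ((T.planeChart hm v).symm.trans (T.planeChart hm v')).source = planeEquiv.symm ⁻¹'
      ((T.vertexChart hm v).symm.trans (T.vertexChart hm v')).source := by
    ext x
    rfl
  rw [hs]
  exact h

/-- The charted space given by the vertex charts. -/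
@[reducible]
noncomputable def vertexChartedSpace : ChartedSpace (EuclideanSpace ℝ (Fin 2)) T.Surface where
  atlas := range (T.planeChart hm)
  chartAt p := T.planeChart hm (T.exists_mem_star p).choose
  mem_chart_source p := by
    change p ∈ (T.vertexChart hm _).source
    rw [T.vertexChart_source]
    exact (T.exists_mem_star p).choose_spec
  chart_mem_atlas p := mem_range_self _

end Charts

theorem isClosedOrientableSurface [Finite S] [Nonempty S] (hm : m ≠ 0) (h : ∀ s s', Relation.ReflTransGen
    (fun s s' => ∃ r r', T.vert (s, r) = T.vert (s', r')) s s') :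
    IsClosedOrientableSurface T.Surface where
  compactSpace := T.compactSpace_surface
  t2Space := inferInstance
  connectedSpace := T.connectedSpace_surface h
  exists_orientedAtlas := by
    refine ⟨T.vertexChartedSpace hm, ?_, ?_⟩
    · let _ := T.vertexChartedSpace hm
      refine isManifold_of_contDiffOn _ _ _ ?_
      rintro _ _ ⟨v, rfl⟩ ⟨v', rfl⟩
      simpa using (T.planeChart_transition hm v v').1
    · rintro _ ⟨v, rfl⟩ _ ⟨v', rfl⟩
      exact (T.planeChart_transition hm v v').2

/-! ### The cubulation and its vertices. -/

theorem exists_face_of_image (s : S) (r r' : ZMod 4) {F : Set (I × I)} (hF : IsSquareFace F) :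
    ∃ F', IsSquareFace F' ∧ T.square (s, r) '' F = T.square (s, r') '' F' := by
  have h (n : ℕ) : ∃ F', IsSquareFace F' ∧
      T.square (s, r) '' F = T.square (s, r + n) '' F' := by
    induction n with
    | zero => exact ⟨F, hF, by simp⟩
    | succ n ih =>
      obtain ⟨F', h1, h2⟩ := ih
      refine ⟨_, h1.image_quarterTurn, ?_⟩
      rw [h2, image_image, Nat.cast_succ, ← add_assoc]
      exact image_congr fun z _ => Subtype.ext (T.cell_quarterTurn _ _ _).symm
  simpa using h (r' - r).val

theorem range_inter_range {d d' : S × ZMod 4} (hv : T.vert d = T.vert d') :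
    range (T.square d) ∩ range (T.square d') =
      T.square d '' {z | ∃ z', T.Glued d z d' z'} := by
  ext p
  constructor
  · rintro ⟨⟨z, rfl⟩, ⟨z', hz'⟩⟩
    exact ⟨z, ⟨z', (T.glued_iff_square_eq hv).2 hz'.symm⟩, rfl⟩
  · rintro ⟨z, ⟨z', hz'⟩, rfl⟩
    exact ⟨mem_range_self _, z', ((T.glued_iff_square_eq hv).1 hz').symm⟩

theorem isSquareFace_glued {d d' : S × ZMod 4} (hne : d ≠ d') :
    IsSquareFace {z | ∃ z', T.Glued d z d' z'} := by
  right
  by_cases h1 : T.next d = d'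
  · refine ⟨{0}, univ, .inl rfl, .inr (.inr rfl), ?_⟩
    ext ⟨x, y⟩
    constructor
    · rintro ⟨z', ⟨h, -⟩ | ⟨h, -⟩ | ⟨-, h, -⟩ | ⟨h, -⟩⟩
      · exact absurd h hne
      · exact ⟨congrArg Prod.fst h, mem_univ _⟩
      · exact ⟨h, mem_univ _⟩
      · exact absurd (h1 ▸ h) (T.next_next_ne d)
    · rintro ⟨h, -⟩
      exact ⟨(y, 0), .inr (.inr (.inl ⟨h1, h, rfl, rfl⟩))⟩
  by_cases h2 : T.next d' = d
  · refine ⟨univ, {0}, .inr (.inr rfl), .inl rfl, ?_⟩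
    ext ⟨x, y⟩
    constructor
    · rintro ⟨z', ⟨h, -⟩ | ⟨h, -⟩ | ⟨h, -⟩ | ⟨-, -, h, -⟩⟩
      · exact absurd h hne
      · exact ⟨mem_univ _, congrArg Prod.snd h⟩
      · exact absurd h h1
      · exact ⟨mem_univ _, h⟩
    · rintro ⟨-, h⟩
      exact ⟨(0, x), .inr (.inr (.inr ⟨h2, rfl, h, rfl⟩))⟩
  · refine ⟨{0}, {0}, .inl rfl, .inl rfl, ?_⟩
    ext ⟨x, y⟩
    constructor
    · rintro ⟨z', ⟨h, -⟩ | ⟨h, -⟩ | ⟨h, -⟩ | ⟨h, -⟩⟩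
      · exact absurd h hne
      · exact ⟨congrArg Prod.fst h, congrArg Prod.snd h⟩
      · exact absurd h h1
      · exact absurd h h2
    · rintro ⟨h, h'⟩
      exact ⟨0, .inr (.inl ⟨Prod.ext h h', rfl⟩)⟩

theorem exists_vert_eq_of_square_eq {s s' : S} {z z' : I × I} {r : ZMod 4}
    (h : T.square (s, 0) z = T.square (s', 0) z') (hr : cornerWeight r z ≠ 0) :
    ∃ r', T.vert (s, r) = T.vert (s', r') := by
  have hc : T.cell (s', 0) z' (T.corner (s, 0) r) ≠ 0 := by
    have h' : T.cell (s, 0) z = T.cell (s', 0) z' := congrArg Subtype.val h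
    rwa [← h', T.cell_corner]
  obtain ⟨j, hj, -⟩ := T.exists_corner_of_cell_ne_zero hc
  simp only [corner, zero_add] at hj
  exact ⟨j, hj.symm⟩

/-- Squares that meet share a vertex, by comparing supports; with that vertex as common origin the
intersection is read off from the gluing. -/
theorem exists_face_inter {s s' : S} (hne : s ≠ s') : ∃ F, IsSquareFace F ∧
    range (T.square (s, 0)) ∩ range (T.square (s', 0)) = T.square (s, 0) '' F := by
  by_cases h : ∃ r r', T.vert (s, r) = T.vert (s', r')
  · obtain ⟨r, r', hr⟩ := h
    obtain ⟨F, hF, h⟩ := T.exists_face_of_image s r 0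
      (T.isSquareFace_glued (d := (s, r)) (d' := (s', r')) fun h => hne (congrArg Prod.fst h))
    refine ⟨F, hF, ?_⟩
    rw [← h, ← T.range_inter_range hr, T.range_square_eq s 0 r, T.range_square_eq s' 0 r']
  · refine ⟨∅, .inl rfl, ?_⟩
    rw [image_empty, eq_empty_iff_forall_notMem]
    rintro _ ⟨⟨z, rfl⟩, z', hz'⟩
    obtain ⟨r, hr⟩ := exists_cornerWeight_ne_zero z
    exact h ⟨r, T.exists_vert_eq_of_square_eq hz'.symm hr⟩

/-- The centre of a square lies on no axis of any of its corners, so it belongs to no other square.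
-/
theorem range_square_injective : Function.Injective fun s => range (T.square (s, 0)) := by
  intro s s' h
  by_contra hne
  let c : I := ⟨1 / 2, by norm_num, by norm_num⟩
  have hc : (c : ℝ) = 1 / 2 := rfl
  have hc0 : c ≠ 0 := fun h => by
    have := congrArg Subtype.val h
    rw [hc] at this
    norm_num at this
  dsimp only at h
  obtain ⟨z', hz'⟩ := h ▸ mem_range_self (f := T.square (s, 0)) (c, c)
  obtain ⟨r', hr'⟩ := T.exists_vert_eq_of_square_eq (r := 0) hz'.symm (by
    rw [cornerWeight_zero]; norm_num [hc])
  obtain ⟨z'', hz'', -⟩ := T.exists_square_eq s' 0 r' z'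
  have h3 := (T.axis_of_cell_eq hr' (fun h => hne (congrArg Prod.fst h))
    (congrArg Subtype.val (hz''.trans hz').symm)).2.2
  exact h3.elim hc0 hc0

/-- The cubulation of the surface by its squares. -/
noncomputable def cubulation [Finite S] : SquareCubulation T.Surface where
  Square := S
  finite_square := ‹_›
  map s := T.square (s, 0)
  isEmbedding_map s :=
    ((T.continuous_square _).isClosedEmbedding (T.square_injective _)).isEmbedding
  iUnion_range := T.iUnion_range_square
  range_injective := T.range_square_injective
  inter_isFace s s' := by
    rcases eq_or_ne s s' with rfl | hne
    · have h : IsSquareFace univ :=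
        .inr ⟨univ, univ, .inr (.inr rfl), .inr (.inr rfl), univ_prod_univ.symm⟩
      exact ⟨univ, univ, h, h, by simp, by simp⟩
    · obtain ⟨F, hF, h⟩ := T.exists_face_inter hne
      obtain ⟨G, hG, h'⟩ := T.exists_face_inter hne.symm
      exact ⟨F, G, hF, hG, h, by rw [inter_comm, h']⟩

theorem exists_square_zero_of_corner (s : S) {z : I × I} (hz : z ∈ squareCorners) :
    ∃ r, T.square (s, 0) z = T.square (s, r) 0 := by
  have q (r : ZMod 4) (z : I × I) : T.square (s, r) z = T.square (s, r + 1) (quarterTurn z) :=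
    Subtype.ext (T.cell_quarterTurn s r z).symm
  have e1 : quarterTurn (1, 0) = 0 := by simp [quarterTurn]
  have e2 : quarterTurn (1, 1) = (1, 0) := by simp [quarterTurn]
  have e3 : quarterTurn (0, 1) = (1, 1) := by simp [quarterTurn]
  obtain ⟨x, y⟩ := z
  obtain ⟨rfl | hx, rfl | hy⟩ := hz
  · exact ⟨0, rfl⟩
  · obtain rfl : y = 1 := hy
    exact ⟨_, by rw [q, e3, q, e2, q, e1]⟩
  · obtain rfl : x = 1 := hx
    exact ⟨_, by rw [q, e1]⟩
  · obtain rfl : x = 1 := hx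
    obtain rfl : y = 1 := hy
    exact ⟨_, by rw [q, e2, q, e1]⟩

theorem numVertices_cubulation_le [Finite S] : T.cubulation.numVertices ≤ Nat.card V := by
  have : Finite V := Finite.of_surjective _ T.vert_surjective
  choose d hd using T.vert_surjective
  have hsub : T.cubulation.vertices ⊆ range fun v => T.square (d v) 0 := by
    intro p hp
    obtain ⟨s, z, hz, rfl⟩ := mem_iUnion.1 hp
    obtain ⟨r, hr⟩ := T.exists_square_zero_of_corner s hz
    refine ⟨T.vert (s, r), ?_⟩
    change T.square _ 0 = T.square (s, 0) z
    rw [hr]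
    exact (T.glued_iff_square_eq (hd _)).1 (.inr (.inl ⟨rfl, rfl⟩))
  calc T.cubulation.numVertices ≤ (range fun v => T.square (d v) 0).ncard :=
        ncard_le_ncard hsub (finite_range _)
    _ ≤ Nat.card V := by
        rw [← image_univ, ← ncard_univ]
        exact ncard_image_le finite_univ

end QuadMap

/-! ### The branched cover of the torus. -/

namespace TorusCover

/-- The displacement of the corner `r` of a square from its lower left corner. -/
def offset (r : ZMod 4) : ZMod 4 × ZMod 4 :=
  (![(0, 0), (1, 0), (1, 1), (0, 1)] : Fin 4 → ZMod 4 × ZMod 4) r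

/-- The sheet displacement when crossing a vertical edge rightwards. -/
def shift (p : ZMod 4 × ZMod 4) : ℤ × ℤ :=
  (![![(0, 0), (1, 0), (1, 1), (0, 1)], ![(1, 0), (0, 1), (-1, 0), (0, -1)],
    ![(0, 0), (1, 0), (1, 1), (0, 1)], ![(1, 0), (0, 1), (-1, 0), (0, -1)]] :
      Fin 4 → Fin 4 → ℤ × ℤ) p.1 p.2

/-- The sheet displacement of a counterclockwise loop around a vertex of the torus. -/
def monodromy (p : ZMod 4 × ZMod 4) : ℤ × ℤ := shift (p.1, p.2 - 1) - shift p

/-- The table `shift` makes the monodromies run through the four axis unit vectors where the first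
coordinate is even, and through (±1, ±1) where it is odd. The norms 1 and 2 are units for odd m. -/
theorem monodromy_norm_dvd : ∀ p, (monodromy p).1 ^ 2 + (monodromy p).2 ^ 2 ∣ 2 := by
  decide +kernel

/-- This independence at distinct corners is what the table is designed for: adjacent columns give
determinants ±1, and vertical neighbours ±1 or ±2. -/
theorem monodromy_det_dvd : ∀ (p : ZMod 4 × ZMod 4) (r r' : ZMod 4), r ≠ r' →
    (monodromy (p + offset r)).1 * (monodromy (p + offset r')).2 -
      (monodromy (p + offset r)).2 * (monodromy (p + offset r')).1 ∣ 2 := by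
  decide +kernel

theorem offset_injective : Function.Injective offset := by
  unfold Function.Injective; decide

/-- The edge displacements ±e₁, ±e₂ and the diagonal ones (±1, ±1) are eight distinct classes modulo
4, so the displacement between two corners tells where a flag sits in its square. -/
theorem offset_edge_injective : ∀ r r' : ZMod 4,
    offset (r + 1) - offset r = offset (r' + 1) - offset r' → r = r' := by
  decide

theorem offset_opp_injective : ∀ r r' : ZMod 4,
    offset (r + 2) - offset r = offset (r' + 2) - offset r' → r = r' := by
  decide

theorem offset_edge_ne_opp : ∀ r r' : ZMod 4,
    offset (r + 1) - offset r ≠ offset (r' + 2) - offset r' := by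
  decide

variable {m : ℕ}

theorem isUnit_of_dvd_two (h2 : IsUnit (2 : ZMod m)) {k : ℤ} (hk : k ∣ 2) :
    IsUnit (k : ZMod m) := by
  refine isUnit_of_dvd_unit ?_ h2
  simpa using map_dvd (Int.castRingHom (ZMod m)) hk

/-- Reduction of an integral vector. -/
def red (m : ℕ) (y : ℤ × ℤ) : ZMod m × ZMod m := (y.1, y.2)

/-- The invariant of a sheet that distinguishes the vertices above a vertex of the torus. -/
def level (p : ZMod 4 × ZMod 4) (g : ZMod m × ZMod m) : ZMod m :=
  (monodromy p).1 * g.2 - (monodromy p).2 * g.1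

theorem level_add (p : ZMod 4 × ZMod 4) (g h : ZMod m × ZMod m) :
    level p (g + h) = level p g + level p h := by
  simp only [level, Prod.fst_add, Prod.snd_add]; ring

theorem level_smul_monodromy (p : ZMod 4 × ZMod 4) (t : ZMod m) :
    level p (t • red m (monodromy p)) = 0 := by
  simp only [level, red, Prod.smul_mk, smul_eq_mul]; ring

/-- The two shifts differ by the monodromy at (i, j), whose level there is 0. -/
theorem level_shift (i j : ZMod 4) (g : ZMod m × ZMod m) :
    level (i, j) (g + red m (shift (i, j - 1))) = level (i, j) (g + red m (shift (i, j))) := by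
  simp only [level, red, monodromy, Prod.fst_add, Prod.snd_add, Prod.fst_sub, Prod.snd_sub]
  push_cast
  ring

/-- The level is the determinant against the monodromy vector; as the norm is a unit, its kernel is
the line of that vector. Levels thus label the cosets, that is, the vertices of a fibre. -/
theorem exists_smul_of_level_eq (h2 : IsUnit (2 : ZMod m)) {p : ZMod 4 × ZMod 4}
    {g g' : ZMod m × ZMod m} (h : level p g = level p g') :
    ∃ t : ZMod m, g' = g + t • red m (monodromy p) := by
  obtain ⟨u, hu⟩ := (isUnit_of_dvd_two h2 (monodromy_norm_dvd p)).exists_right_inv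
  obtain ⟨a, b⟩ := g
  obtain ⟨a', b'⟩ := g'
  push_cast at hu
  simp only [level] at h
  refine ⟨u * ((monodromy p).1 * (a' - a) + (monodromy p).2 * (b' - b)), Prod.ext ?_ ?_⟩ <;>
    simp only [red, Prod.smul_mk, smul_eq_mul, Prod.mk_add_mk]
  · linear_combination (-(a' - a)) * hu + u * (monodromy p).2 * h
  · linear_combination (-(b' - b)) * hu - u * (monodromy p).1 * h

/-- Cramer's rule for two independent linear forms. -/
theorem eq_of_level_eq (h2 : IsUnit (2 : ZMod m)) {p : ZMod 4 × ZMod 4} {r r' : ZMod 4}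
    (hr : r ≠ r') {g g' : ZMod m × ZMod m} (h : level (p + offset r) g = level (p + offset r) g')
    (h' : level (p + offset r') g = level (p + offset r') g') : g = g' := by
  have hu := isUnit_of_dvd_two h2 (monodromy_det_dvd p r r' hr)
  push_cast at hu
  obtain ⟨a, b⟩ := g
  obtain ⟨a', b'⟩ := g'
  simp only [level] at h h'
  refine Prod.ext (hu.mul_left_cancel ?_) (hu.mul_left_cancel ?_)
  · linear_combination ((monodromy (p + offset r')).1 : ZMod m) * h -
      ((monodromy (p + offset r)).1 : ZMod m) * h'
  · linear_combination ((monodromy (p + offset r')).2 : ZMod m) * h -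
      ((monodromy (p + offset r)).2 : ZMod m) * h'

/-- The squares: a square of the torus and a sheet. -/
abbrev Tile (m : ℕ) : Type := (ZMod 4 × ZMod 4) × (ZMod m × ZMod m)

/-- The square entered when turning counterclockwise about the corner `r`. -/
def step (r : ZMod 4) (s : Tile m) : Tile m :=
  (![((s.1.1 - 1, s.1.2), s.2 - red m (shift s.1)),
    ((s.1.1, s.1.2 - 1), s.2),
    ((s.1.1 + 1, s.1.2), s.2 + red m (shift (s.1.1 + 1, s.1.2))),
    ((s.1.1, s.1.2 + 1), s.2)] : Fin 4 → Tile m) r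

theorem step_zero (s : Tile m) :
    step 0 s = ((s.1.1 - 1, s.1.2), s.2 - red m (shift s.1)) := rfl

theorem step_one (s : Tile m) : step 1 s = ((s.1.1, s.1.2 - 1), s.2) := rfl

theorem step_two (s : Tile m) :
    step 2 s = ((s.1.1 + 1, s.1.2), s.2 + red m (shift (s.1.1 + 1, s.1.2))) := rfl

theorem step_three (s : Tile m) : step 3 s = ((s.1.1, s.1.2 + 1), s.2) := rfl

/-- Crossing an edge and crossing it back; this provides the inverse of `rotate`. -/
theorem step_step (r : ZMod 4) (s : Tile m) : step (r + 2) (step r s) = s := by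
  obtain ⟨⟨i, j⟩, g⟩ := s
  rcases ZMod.four_cases r with rfl | rfl | rfl | rfl
  · rw [show (0 + 2 : ZMod 4) = 2 from rfl, step_zero, step_two]; simp
  · rw [show (1 + 2 : ZMod 4) = 3 from rfl, step_one, step_three]; simp
  · rw [show (2 + 2 : ZMod 4) = 0 from rfl, step_two, step_zero]; simp
  · rw [show (3 + 2 : ZMod 4) = 1 from rfl, step_three, step_one]; simp

/-- Counterclockwise rotation of the flags about their vertices. -/
def rotate (m : ℕ) : Equiv.Perm (Tile m × ZMod 4) where
  toFun d := (step d.2 d.1, d.2 + 1)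
  invFun d := (step (d.2 + 1) d.1, d.2 - 1)
  left_inv d := by
    dsimp only
    rw [add_assoc, show (1 + 1 : ZMod 4) = 2 from rfl, step_step, add_sub_cancel_right]
  right_inv d := by
    dsimp only
    have h := step_step (d.2 + 1) d.1
    rw [add_assoc, show (1 + 2 : ZMod 4) = -1 from rfl, ← sub_eq_add_neg] at h
    rw [h, sub_add_cancel]

theorem rotate_apply (s : Tile m) (r : ZMod 4) : rotate m (s, r) = (step r s, r + 1) := rfl

/-- The change of sheet from the lower left corner of a square to the corner `r`. -/
def transport (p : ZMod 4 × ZMod 4) (r : ZMod 4) : ℤ × ℤ :=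
  (![0, shift (p.1 + 1, p.2), shift (p.1 + 1, p.2), 0] : Fin 4 → ℤ × ℤ) r

/-- The vertex of a flag. -/
def flagVert (d : Tile m × ZMod 4) : (ZMod 4 × ZMod 4) × ZMod m :=
  (d.1.1 + offset d.2, level (d.1.1 + offset d.2) (d.1.2 + red m (transport d.1.1 d.2)))

theorem flagVert_zero (i j : ZMod 4) (g : ZMod m × ZMod m) :
    flagVert (((i, j), g), 0) = ((i, j), level (i, j) g) := by
  have h : (i, j) + offset 0 = (i, j) := by simp [offset]
  have h' : g + red m (transport (i, j) 0) = g := by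
    change g + red m 0 = g; simp [red]
  simp only [flagVert, h, h']

theorem flagVert_one (i j : ZMod 4) (g : ZMod m × ZMod m) :
    flagVert (((i, j), g), 1) =
      ((i + 1, j), level (i + 1, j) (g + red m (shift (i + 1, j)))) := by
  have h : (i, j) + offset 1 = (i + 1, j) := by simp [offset]
  simp only [flagVert, h]
  rfl

theorem flagVert_two (i j : ZMod 4) (g : ZMod m × ZMod m) :
    flagVert (((i, j), g), 2) =
      ((i + 1, j + 1), level (i + 1, j + 1) (g + red m (shift (i + 1, j)))) := by
  have h : (i, j) + offset 2 = (i + 1, j + 1) := rfl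
  simp only [flagVert, h]
  rfl

theorem flagVert_three (i j : ZMod 4) (g : ZMod m × ZMod m) :
    flagVert (((i, j), g), 3) = ((i, j + 1), level (i, j + 1) g) := by
  have h : (i, j) + offset 3 = (i, j + 1) := by
    change (i + 0, j + 1) = _; rw [add_zero]
  have h' : g + red m (transport (i, j) 3) = g := by
    change g + red m 0 = g; simp [red]
  simp only [flagVert, h, h']

theorem flagVert_rotate (d : Tile m × ZMod 4) : flagVert (rotate m d) = flagVert d := by
  obtain ⟨⟨⟨i, j⟩, g⟩, r⟩ := d
  rcases ZMod.four_cases r with rfl | rfl | rfl | rfl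
  · rw [rotate_apply, step_zero, zero_add, flagVert_one, flagVert_zero]; simp
  · rw [rotate_apply, step_one, show (1 + 1 : ZMod 4) = 2 from rfl, flagVert_two, flagVert_one]
    simp [level_shift]
  · rw [rotate_apply, step_two, show (2 + 1 : ZMod 4) = 3 from rfl, flagVert_three, flagVert_two]
  · rw [rotate_apply, step_three, show (3 + 1 : ZMod 4) = 0 from rfl, flagVert_zero,
      flagVert_three]

theorem flagVert_edge (d : Tile m × ZMod 4) :
    flagVert (d.1, d.2 + 3) = flagVert ((rotate m d).1, d.2 + 2) := by
  obtain ⟨⟨⟨i, j⟩, g⟩, r⟩ := d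
  dsimp only [rotate_apply]
  rcases ZMod.four_cases r with rfl | rfl | rfl | rfl
  · rw [step_zero, zero_add, zero_add, flagVert_three, flagVert_two]
    have := level_shift i (j + 1) (g - red m (shift (i, j)))
    simp_all
  · rw [step_one, show (1 + 3 : ZMod 4) = 0 from rfl, show (1 + 2 : ZMod 4) = 3 from rfl,
      flagVert_zero, flagVert_three]
    simp
  · rw [step_two, show (2 + 3 : ZMod 4) = 1 from rfl, show (2 + 2 : ZMod 4) = 0 from rfl,
      flagVert_one, flagVert_zero]
  · rw [step_three, show (3 + 3 : ZMod 4) = 2 from rfl, show (3 + 2 : ZMod 4) = 1 from rfl,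
      flagVert_two, flagVert_one]
    have := level_shift (i + 1) (j + 1) g
    simp_all

/-- A full turn about the torus vertex crosses two vertical edges, in opposite directions, whose
shifts add up to the monodromy. -/
theorem rotate_pow_four (s : Tile m) (r : ZMod 4) :
    (rotate m ^ 4) (s, r) = ((s.1, s.2 + red m (monodromy (s.1 + offset r))), r) := by
  obtain ⟨⟨i, j⟩, g⟩ := s
  have e0 : offset 0 = (0, 0) := rfl
  have e1 : offset 1 = (1, 0) := rfl
  have e2 : offset 2 = (1, 1) := rfl
  have e3 : offset 3 = (0, 1) := rfl
  have a1 : (1 + 1 : ZMod 4) = 2 := rfl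
  have a2 : (2 + 1 : ZMod 4) = 3 := rfl
  have a3 : (3 + 1 : ZMod 4) = 0 := rfl
  have hred (y y' : ℤ × ℤ) : red m (y - y') = red m y - red m y' := by simp [red]
  change rotate m (rotate m (rotate m (rotate m _))) = _
  simp only [rotate_apply]
  rcases ZMod.four_cases r with rfl | rfl | rfl | rfl <;>
    simp only [zero_add, a1, a2, a3, step_zero, step_one, step_two, step_three, e0, e1, e2, e3,
      monodromy, hred, Prod.mk_add_mk, add_zero, sub_add_cancel, add_sub_cancel_right] <;>
    congr 2 <;> abel

theorem rotate_zpow_four_mul (s : Tile m) (r : ZMod 4) (k : ℤ) :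
    (rotate m ^ (4 * k)) (s, r) =
      ((s.1, s.2 + (k : ZMod m) • red m (monodromy (s.1 + offset r))), r) := by
  rw [zpow_mul, show rotate m ^ (4 : ℤ) = rotate m ^ 4 from rfl]
  induction k with
  | zero => simp
  | succ n ih =>
    rw [add_comm, zpow_one_add, Equiv.Perm.mul_apply, ih, rotate_pow_four]
    push_cast
    rw [add_smul, one_smul]
    congr 2; abel
  | pred n ih =>
    refine (rotate m ^ 4).injective ?_
    rw [← Equiv.Perm.mul_apply, ← zpow_one_add, add_sub_cancel, ih, rotate_pow_four]
    push_cast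
    rw [sub_smul, one_smul]
    congr 2; abel

theorem smul_monodromy_eq_zero (h2 : IsUnit (2 : ZMod m)) {p : ZMod 4 × ZMod 4} {t : ZMod m}
    (h : t • red m (monodromy p) = 0) : t = 0 := by
  have hu := isUnit_of_dvd_two h2 (monodromy_norm_dvd p)
  push_cast at hu
  have h1 : t * (monodromy p).1 = 0 := congrArg Prod.fst h
  have h3 : t * (monodromy p).2 = 0 := congrArg Prod.snd h
  refine hu.mul_left_cancel ?_
  linear_combination ((monodromy p).1 : ZMod m) * h1 + ((monodromy p).2 : ZMod m) * h3

/-- The corner number forces 4 to divide k, and each group of four rotations adds a vector of order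
m. -/
theorem rotate_zpow_eq_self_iff (h2 : IsUnit (2 : ZMod m)) (d : Tile m × ZMod 4) (k : ℤ) :
    (rotate m ^ k) d = d ↔ (4 * m : ℤ) ∣ k := by
  obtain ⟨s, r⟩ := d
  constructor
  · intro h
    have h4 := congrArg Prod.snd h
    rw [Equiv.Perm.zpow_apply_snd (fun _ => rfl), add_eq_left,
      ZMod.intCast_zmod_eq_zero_iff_dvd] at h4
    obtain ⟨j, rfl⟩ := h4
    rw [show ((4 : ℕ) : ℤ) = 4 from rfl, rotate_zpow_four_mul] at h
    have hj := smul_monodromy_eq_zero h2 (add_eq_left.1 (congrArg (fun d => d.1.2) h))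
    rw [ZMod.intCast_zmod_eq_zero_iff_dvd] at hj
    exact mul_dvd_mul_left _ hj
  · rintro ⟨j, rfl⟩
    rw [mul_assoc, rotate_zpow_four_mul]
    simp

theorem exists_rotate_zpow [NeZero m] (h2 : IsUnit (2 : ZMod m)) (d d' : Tile m × ZMod 4)
    (h : flagVert d = flagVert d') : ∃ k : ℤ, (rotate m ^ k) d = d' := by
  have base (d : Tile m × ZMod 4) : ∃ (k : ℤ) (s : Tile m), (rotate m ^ k) d = (s, 0) := by
    refine ⟨-(d.2.val : ℤ), _, Prod.ext rfl ?_⟩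
    rw [Equiv.Perm.zpow_apply_snd (fun _ => rfl)]
    simp
  obtain ⟨k, ⟨⟨i, j⟩, g⟩, hk⟩ := base d
  obtain ⟨k', ⟨⟨i', j'⟩, g'⟩, hk'⟩ := base d'
  rw [← Equiv.Perm.apply_zpow_apply flagVert_rotate k,
    ← Equiv.Perm.apply_zpow_apply flagVert_rotate k' d', hk, hk', flagVert_zero, flagVert_zero,
    Prod.mk.injEq] at h
  obtain ⟨h, hl⟩ := h
  obtain ⟨rfl, rfl⟩ := Prod.mk.injEq .. ▸ h
  obtain ⟨t, rfl⟩ := exists_smul_of_level_eq h2 hl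
  have ht := rotate_zpow_four_mul ((i, j), g) 0 t.val
  rw [show (i, j) + offset 0 = (i, j) by simp [offset], Int.cast_natCast, ZMod.natCast_zmod_val,
    ← hk, ← hk'] at ht
  refine ⟨-k' + 4 * t.val + k, ?_⟩
  rw [zpow_add, zpow_add, Equiv.Perm.mul_apply, Equiv.Perm.mul_apply, ht, ← Equiv.Perm.mul_apply,
    ← zpow_add]
  simp

theorem tile_eq_of_flagVert_eq (h2 : IsUnit (2 : ZMod m)) {s s' : Tile m} {r r' : ZMod 4}
    (hr : r ≠ r') (h : flagVert (s, r) = flagVert (s', r))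
    (h' : flagVert (s, r') = flagVert (s', r')) : s = s' := by
  obtain ⟨p, g⟩ := s
  obtain ⟨p', g'⟩ := s'
  obtain rfl : p = p' := add_right_cancel (congrArg Prod.fst h)
  have h1 := congrArg Prod.snd h
  have h3 := congrArg Prod.snd h'
  simp only [flagVert, level_add, add_left_inj] at h1 h3
  rw [eq_of_level_eq h2 hr h1 h3]

theorem offset_sub_eq {s s' : Tile m} {r r' j j' : ZMod 4}
    (h : flagVert (s, r) = flagVert (s', r')) (h' : flagVert (s, r + j) = flagVert (s', r' + j')) :
    offset (r + j) - offset r = offset (r' + j') - offset r' := by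
  have h1 : s.1 + offset r = s'.1 + offset r' := congrArg Prod.fst h
  have h3 : s.1 + offset (r + j) = s'.1 + offset (r' + j') := congrArg Prod.fst h'
  linear_combination h3 - h1

/-- The `(ZMod m)²`-cover of the `4 × 4` square torus, branched over all vertices. -/
def quadMap [NeZero m] (h2 : IsUnit (2 : ZMod m)) :
    QuadMap (Tile m) ((ZMod 4 × ZMod 4) × ZMod m) m where
  next := rotate m
  vert := flagVert
  vert_surjective := by
    rintro ⟨⟨i, j⟩, c⟩
    obtain ⟨u, hu⟩ := (isUnit_of_dvd_two h2 (monodromy_norm_dvd (i, j))).exists_right_inv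
    push_cast at hu
    refine ⟨(((i, j), (-(u * (monodromy (i, j)).2 * c), u * (monodromy (i, j)).1 * c)), 0), ?_⟩
    rw [flagVert_zero]
    refine Prod.ext rfl ?_
    simp only [level]
    linear_combination c * hu
  next_snd _ := rfl
  vert_next := flagVert_rotate
  vert_edge := flagVert_edge
  exists_zpow := exists_rotate_zpow h2
  zpow_eq_self_iff := rotate_zpow_eq_self_iff h2
  vert_injective _ _ _ h := offset_injective (add_left_cancel (congrArg Prod.fst h))
  edge_injective := by
    rintro ⟨s, r⟩ ⟨s', r'⟩ h h'
    obtain rfl := offset_edge_injective _ _ (offset_sub_eq h h')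
    rw [tile_eq_of_flagVert_eq h2 (fun h => absurd (left_eq_add.1 h) (by decide)) h h']
  opp_injective := by
    rintro ⟨s, r⟩ ⟨s', r'⟩ h h'
    obtain rfl := offset_opp_injective _ _ (offset_sub_eq h h')
    rw [tile_eq_of_flagVert_eq h2 (fun h => absurd (left_eq_add.1 h) (by decide)) h h']
  edge_ne_opp := by
    rintro ⟨s, r⟩ ⟨s', r'⟩ h h'
    exact offset_edge_ne_opp _ _ (offset_sub_eq h h')

/-- Moves up and to the right reach any square of the torus; within one square, the monodromies at
two corners span all sheets. -/
theorem reflTransGen_flagVert (h2 : IsUnit (2 : ZMod m)) (s s' : Tile m) :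
    Relation.ReflTransGen (fun s s' : Tile m => ∃ r r', flagVert (s, r) = flagVert (s', r'))
      s s' := by
  have hup (s : Tile m) (n : ℕ) : ∃ g, Relation.ReflTransGen
      (fun s s' : Tile m => ∃ r r', flagVert (s, r) = flagVert (s', r'))
      s ((s.1.1, s.1.2 + n), g) := by
    induction n with
    | zero => exact ⟨s.2, by simpa using .refl⟩
    | succ n ih =>
      obtain ⟨g, hg⟩ := ih
      refine ⟨g, hg.tail ?_⟩
      have h : step 3 ((s.1.1, s.1.2 + n), g) = ((s.1.1, s.1.2 + (n + 1 : ℕ)), g) := by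
        rw [step_three]; push_cast; rw [add_assoc]
      exact ⟨3, 0, by rw [← h]; exact (flagVert_rotate (_, 3)).symm⟩
  have hright (s : Tile m) (n : ℕ) : ∃ g, Relation.ReflTransGen
      (fun s s' : Tile m => ∃ r r', flagVert (s, r) = flagVert (s', r'))
      s ((s.1.1 + n, s.1.2), g) := by
    induction n with
    | zero => exact ⟨s.2, by simpa using .refl⟩
    | succ n ih =>
      obtain ⟨g, hg⟩ := ih
      refine ⟨(step 2 ((s.1.1 + n, s.1.2), g)).2, hg.tail ⟨2, 3, ?_⟩⟩
      have h : ((s.1.1 + (n + 1 : ℕ), s.1.2), (step 2 ((s.1.1 + n, s.1.2), g)).2) =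
          step 2 ((s.1.1 + n, s.1.2), g) := by
        rw [step_two]; push_cast; rw [add_assoc]
      rw [h]
      exact (flagVert_rotate (_, 2)).symm
  have hsheet (p : ZMod 4 × ZMod 4) (g g' : ZMod m × ZMod m) : Relation.ReflTransGen
      (fun s s' : Tile m => ∃ r r', flagVert (s, r) = flagVert (s', r')) (p, g) (p, g') := by
    obtain ⟨i, j⟩ := p
    have hu := isUnit_of_dvd_two h2 (monodromy_det_dvd (i, j) 0 3 (by decide))
    rw [show (i, j) + offset 0 = (i, j) by simp [offset],
      show (i, j) + offset 3 = (i, j + 1) by simp [offset]] at hu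
    obtain ⟨u, hu⟩ := hu.exists_right_inv
    push_cast at hu
    -- Adding a multiple of the monodromy at corner 0 keeps that vertex; `t` makes the level at
    -- corner 3 agree with that of `g'`.
    set t : ZMod m := u * (level (i, j + 1) g - level (i, j + 1) g') with ht
    have h1 : flagVert (((i, j), g), 0) =
        flagVert (((i, j), g + t • red m (monodromy (i, j))), 0) := by
      rw [flagVert_zero, flagVert_zero, level_add, level_smul_monodromy, add_zero]
    have h3 : flagVert (((i, j), g + t • red m (monodromy (i, j))), 3) =
        flagVert (((i, j), g'), 3) := by
      rw [flagVert_three, flagVert_three]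
      refine Prod.ext rfl ?_
      have e : level (i, j + 1) (t • red m (monodromy (i, j))) =
          -(level (i, j + 1) g - level (i, j + 1) g') := by
        rw [ht]
        generalize level (i, j + 1) g - level (i, j + 1) g' = c
        simp only [level, red, Prod.smul_mk, smul_eq_mul]
        linear_combination -c * hu
      rw [level_add, e]
      ring
    exact (Relation.ReflTransGen.single ⟨0, 0, h1⟩).tail ⟨3, 3, h3⟩
  obtain ⟨g1, h1⟩ := hup s (s'.1.2 - s.1.2).val
  obtain ⟨g3, h3⟩ := hright ((s.1.1, s.1.2 + (s'.1.2 - s.1.2).val), g1) (s'.1.1 - s.1.1).val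
  refine (h1.trans h3).trans ?_
  simpa using hsheet s'.1 g3 s'.2

end TorusCover

theorem mainTheorem3 :
    ∃ C c : ℝ, 0 < C ∧ 0 < c ∧ ∀ n : ℕ, 1 ≤ n →
      ∃ (M : Type) (_ : TopologicalSpace M), IsClosedOrientableSurface M ∧
        ∃ Q : SquareCubulation M,
          (Q.numVertices : ℝ) ≤ C * n ∧ c * (n : ℝ) ^ 2 ≤ (Q.numSquares : ℝ) := by
  -- For n ≥ 1, 16(2n + 1) ≤ 48n and 16(2n + 1)² ≥ 64n².
  refine ⟨48, 64, by norm_num, by norm_num, fun n hn => ?_⟩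
  have h2 : IsUnit (2 : ZMod (2 * n + 1)) := by
    -- Indeed 2(n + 1) = (2n + 1) + 1.
    refine IsUnit.of_mul_eq_one ((n : ZMod (2 * n + 1)) + 1) ?_
    have h := ZMod.natCast_self (2 * n + 1)
    push_cast at h
    linear_combination h
  have hn' : (1 : ℝ) ≤ n := by exact_mod_cast hn
  refine ⟨(TorusCover.quadMap h2).Surface, inferInstance,
    (TorusCover.quadMap h2).isClosedOrientableSurface (by positivity)
      (TorusCover.reflTransGen_flagVert h2), (TorusCover.quadMap h2).cubulation, ?_, ?_⟩
  · have h := (TorusCover.quadMap h2).numVertices_cubulation_le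
    simp only [Nat.card_prod, Nat.card_zmod] at h
    have h' : ((TorusCover.quadMap h2).cubulation.numVertices : ℝ) ≤ 4 * 4 * (2 * n + 1) := by
      exact_mod_cast h
    linarith
  · have h : (TorusCover.quadMap h2).cubulation.numSquares =
        4 * 4 * ((2 * n + 1) * (2 * n + 1)) := by
      change Nat.card (TorusCover.Tile (2 * n + 1)) = _
      simp only [Nat.card_prod, Nat.card_zmod]
    rw [h]
    push_cast
    nlinarith
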